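/- **Model.** Let $E$ be a ground set of size $n$. An instance of cardinality-constrained monotone submodular maximization is a function $f:2^E\to\mathbb R$ with $f(\emptyset)=0$, $f(S)\le f(T)$ for $S\subseteq T$ and $f(S\cup T)+f(S\cap T)\le f(S)+f(T)$ for all $S,T\subseteq E$, together with an integer $k$; write $\mathrm{OPT}_k(f)=\max\{f(S):|S|\le k\}$. An $r$-round adaptive algorithm with $m$ queries per round has access to $f$ only through value queries: it proceeds in $r$ rounds, in each round it queries at most $m$ sets, which are determined by its random seed and by the answers received in earlier rounds only, and after $r$ rounds it returns a set $S$ with $|S|\le k$. Its computation is otherwise unrestricted. **Theorem.** There are absolute constants $c>0$ and $\kappa>0$ such that for every $d\in\mathbb N$ there is an $n_0$ such that the following holds for all integers $n\ge n_0$ and $r\ge1$ with $r<n^c$. 1. If $r>\log n$, then no (randomized) $r$-round adaptive algorithm with at most $n^d$ queries per round achieves better than a $\left(1-\frac1e-\kappa\,\frac{\log^2 n}{r^3}\right)$-approximation for monotone submodular maximization subject to a cardinality constraint on a ground set of size $n$. 2. Without the assumption $r>\log n$, no such algorithm achieves better than a $\left(1-\frac1e-\kappa\,\min\left\{\frac1r,\frac{\log^2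 n}{r^3}\right\}\right)$-approximation. Here "no algorithm achieves better than a $\beta$-approximation" means: there is a $k$ such that for every such algorithm (which may depend on $n$, $r$, $k$) there is an instance $f$ with $\mathrm{OPT}_k(f)>0$ for which the returned set $S$ satisfies $\mathbb E[f(S)]\le\beta\,\mathrm{OPT}_k(f)$ and $\Pr[f(S)>\beta\,\mathrm{OPT}_k(f)]\le n^{-d}$. -/

import Mathlib

open MeasureTheory

/-- A set function `f : 2^E → ℝ` is normalized (`f ∅ = 0`), monotone and submodular.
In particular it takes only nonnegative values. -/
structure IsMonotoneSubmodular {E : Type} [DecidableEq E] (f : Finset E → ℝ) : Prop where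
  map_empty : f ∅ = 0
  monotone : Monotone f
  submodular : ∀ S T : Finset E, f (S ∪ T) + f (S ∩ T) ≤ f S + f T

/-- The value `max {f(S) : |S| ≤ k}` of an optimal solution under the cardinality constraint `k`. -/
noncomputable def optValue {E : Type} [Fintype E] (f : Finset E → ℝ) (k : ℕ) : ℝ :=
  (Finset.univ.filter fun S : Finset E => S.card ≤ k).sup' ⟨∅, by simp⟩ f

/-- A deterministic adaptive algorithm on the ground set `E`, for the cardinality constraint `k`,
with `m` value queries in each round.

A history is the list of the answers obtained in the earlier rounds, one vector of `m` answers per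
round. Given the history, `query` produces the `m` sets that are queried, all in parallel, in the
next round (repetitions are allowed, so this covers any number of queries up to `m`), and `output`
produces the feasible solution that is returned if the algorithm stops now. There is no bound on
the computation that is done between two rounds. -/
structure AdaptiveAlgorithm (E : Type) (k m : ℕ) where
  query : List (Fin m → ℝ) → Fin m → Finset E
  output : List (Fin m → ℝ) → Finset E
  card_output_le : ∀ h, (output h).card ≤ k

namespace AdaptiveAlgorithm

variable {E : Type} {k m : ℕ}

/-- The history after `r` rounds when the value oracle is `f`. -/
def history (A : AdaptiveAlgorithm E k m) (f : Finset E → ℝ) : ℕ → List (Fin m → ℝ)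
  | 0 => []
  | r + 1 => A.history f r ++ [fun j => f (A.query (A.history f r) j)]

/-- The solution returned after `r` rounds of queries to the value oracle `f`. -/
def run (A : AdaptiveAlgorithm E k m) (f : Finset E → ℝ) (r : ℕ) : Finset E :=
  A.output (A.history f r)

end AdaptiveAlgorithm

/-- A randomized `r`-round adaptive algorithm with `m` queries per round: a random seed `ω` is drawn
from a probability space, and then the deterministic algorithm `alg ω` is run for `r` rounds.
Its output is a random variable, for every value oracle. -/
structure RandomizedAlgorithm (E : Type) (k r m : ℕ) (Ω : Type) [MeasurableSpace Ω] where
  law : Measure Ω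
  isProbabilityMeasure : IsProbabilityMeasure law
  alg : Ω → AdaptiveAlgorithm E k m
  measurableSet_output : ∀ (f : Finset E → ℝ) (S : Finset E),
    MeasurableSet {ω | (alg ω).run f r = S}

/-- On ground sets of size `n`, no randomized algorithm with `r` rounds of at most `m` queries each
does better than the approximation factor `β` for maximizing a monotone submodular function under
a cardinality constraint. There is a cardinality bound `k`, known to the algorithm, such that every
algorithm has an instance `f` with positive optimum on which it gets at most `β` times the optimum,
both in expectation and with probability at least `1 - η`. -/
def NoBetterApproximation (n r m : ℕ) (β η : ℝ) : Prop :=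
  ∃ k : ℕ, ∀ (Ω : Type) [MeasurableSpace Ω] (A : RandomizedAlgorithm (Fin n) k r m Ω),
    ∃ f : Finset (Fin n) → ℝ, IsMonotoneSubmodular f ∧ 0 < optValue f k ∧
      ∫ ω, f ((A.alg ω).run f r) ∂A.law ≤ β * optValue f k ∧
      A.law.real {ω | β * optValue f k < f ((A.alg ω).run f r)} ≤ η

/-!
The hard instances are random. The ground set is split into layers `X_0, …, X_r` and a small hidden
set `Y` by independent random labels; consecutive layers shrink by a factor `1 - g` with
`g = min (1/2) (log n / (16 r))`, so that the last layer is still larger than `Y` by a power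
of `n`. For a set `S` with `c_j` elements in `X_j`, with `x` elements outside `Y` and `y` elements
in `Y`, the fraction that `S` leaves uncovered is, up to constants and with `h = 1/K`,
`(1 - h)^x * (1 + h² ∑_j ((c_j - a c_{j-1} - slack)⁺)² / 16) * θ(y)`, where `a = 1 - g/2`.
Here `θ` is `(1 - h)^y` for small `y` and then decreases linearly to `0` at `y = k`, so `k` elements
of `Y` cover everything.

*Submodularity.* The factor `(1 - h)^x` alone has second differences of order `h²`. The squared
positive parts have second differences bounded below by a constant, and their first differences
are linear in the positive parts, hence dominated by the squares themselves. So the penalty keeps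
the function submodular whatever the scale of `S` is
(`LayerParams.penaltyFactor_second_diff`, `LayerParams.value_isMonotoneSubmodular`).

*Hiding.* Before round `i` the algorithm knows at most the layers before `X_i`, so the other labels
are independent of its query. With high probability `c_{j+1} ≤ a c_j + slack` for `j ≥ i`, since
`c_{j+1}` has mean `(1 - g)` times that of `c_j`, and `y` is tiny or else the set is so large that
the function, truncated at `1 - τ`, is constant. In both cases the answer does not depend on
how the later elements are partitioned (`LayerParams.Balanced.value_eq`), so round `i`
reveals at most `X_i`. The deviation bounds are exponential moment bounds: conditionally on the
known labels, `exp (t (c_{j+1} - a c_j))` has mean at most `1` for a suitable `t`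
(`sum_labelWeight_exp_le`, `LayerParams.Admissible.labelProb_not_balanced_le`).

*The gain.* The returned set, extended to `k` elements, contains almost no element of `Y`. Its
imbalances `c_j - a c_{j-1}` add up to at least `(g/2) k` approximately, so by the Cauchy–Schwarz
inequality the penalty is of order `g²/r` (`LayerParams.penalty_ge`). Its value is therefore less
than `1 - 1/e` by a constant multiple of `g²/r`, which is of the order of
`min (1/r) (log² n / r³)`. All errors are polynomially small in `n`.

Finally, averaging over the seed of a randomized algorithm and over the labels gives labels that
are bad for it (`LayerParams.Admissible.noBetterApproximation`). The first part of the theorem is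
the second one for `r > log n`.
-/

/-! ### Monotone submodular set functions -/

section SetFunctions

variable {E : Type} [DecidableEq E]

/-- A set function is submodular if it is so for pairs of sets `S ∪ {e}`, `S ∪ {e'}`. -/
theorem submodular_of_insert_insert {f : Finset E → ℝ}
    (h : ∀ S, ∀ e ∉ S, ∀ e' ∉ S, e ≠ e' →
      f (insert e (insert e' S)) + f S ≤ f (insert e S) + f (insert e' S)) (S T : Finset E) :
    f (S ∪ T) + f (S ∩ T) ≤ f S + f T := by
  -- the marginal value of `e` decreases when a set `D` is added
  have marg : ∀ (e : E) (A D : Finset E), Disjoint D A → e ∉ A → e ∉ D →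
      f (insert e (D ∪ A)) + f A ≤ f (insert e A) + f (D ∪ A) := by
    intro e A D
    induction D using Finset.induction_on with
    | empty => intro _ _ _; simp
    | insert x D hx ih =>
      intro hd heA heD
      rw [Finset.disjoint_insert_left] at hd
      simp only [Finset.mem_insert, not_or] at heD
      have h1 := ih hd.2 heA heD.2
      have h2 := h (D ∪ A) e (by simp [heA, heD.2]) x (by simp [hx, hd.1]) heD.1
      rw [Finset.insert_union]
      linarith
  have main : ∀ (A D B : Finset E), Disjoint D A → Disjoint B A → Disjoint D B →
      f (D ∪ (B ∪ A)) + f A ≤ f (D ∪ A) + f (B ∪ A) := by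
    intro A D B
    induction D using Finset.induction_on with
    | empty => intro _ _ _; simp; linarith
    | insert x D hx ih =>
      intro hd hB hDB
      rw [Finset.disjoint_insert_left] at hd hDB
      have h1 := ih hd.2 hB hDB.2
      have h2 := marg x (D ∪ A) B
        (by rw [Finset.disjoint_union_right]; exact ⟨hDB.2.symm, hB⟩)
        (by simp [hx, hd.1]) hDB.1
      rw [Finset.insert_union, Finset.insert_union]
      have e1 : B ∪ (D ∪ A) = D ∪ (B ∪ A) := by
        rw [← Finset.union_assoc, Finset.union_comm B D, Finset.union_assoc]
      rw [e1] at h2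
      linarith
  have := main (S ∩ T) (S \ T) (T \ S)
    (Finset.disjoint_left.2 (by simp; tauto)) (Finset.disjoint_left.2 (by simp; tauto))
    (Finset.disjoint_left.2 (by simp; tauto))
  have e1 : S \ T ∪ (T \ S ∪ S ∩ T) = S ∪ T := by ext x; simp; tauto
  have e2 : S \ T ∪ S ∩ T = S := by ext x; simp; tauto
  have e3 : T \ S ∪ S ∩ T = T := by ext x; simp; tauto
  rw [e1, e2, e3] at this
  exact this

/-- Truncating a monotone submodular function at a nonnegative level keeps it monotone and
submodular. -/
theorem IsMonotoneSubmodular.min_const {f : Finset E → ℝ} (hf : IsMonotoneSubmodular f) {c : ℝ}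
    (hc : 0 ≤ c) : IsMonotoneSubmodular fun S => min (f S) c where
  map_empty := by simp [hf.map_empty, hc]
  monotone := fun S T hST => min_le_min_right c (hf.monotone hST)
  submodular := fun S T => by
    have h := hf.submodular S T
    have h1 := hf.monotone (Finset.subset_union_left (s₁ := S) (s₂ := T))
    have h2 := hf.monotone (Finset.subset_union_right (s₁ := S) (s₂ := T))
    have h3 := hf.monotone (Finset.inter_subset_left (s₁ := S) (s₂ := T))
    have h4 := hf.monotone (Finset.inter_subset_right (s₁ := S) (s₂ := T))
    simp only [min_def]
    split_ifs <;> linarith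

end SetFunctions

/-! ### The squared positive part -/

/-- The function `u ↦ (u⁺)²`. -/
noncomputable def sqPos (u : ℝ) : ℝ := max 0 u ^ 2

theorem sqPos_nonneg (u : ℝ) : 0 ≤ sqPos u := sq_nonneg _

theorem sqPos_mono : Monotone sqPos := fun u v h => by
  unfold sqPos
  gcongr

theorem sqPos_second_diff_nonneg (u : ℝ) {s q : ℝ} (hs : 0 ≤ s) (hq : 0 ≤ q) :
    0 ≤ sqPos (u + s + q) - sqPos (u + s) - sqPos (u + q) + sqPos u := by
  unfold sqPos
  rcases max_cases 0 (u + s + q) with ⟨h1, _⟩ | ⟨h1, _⟩ <;>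
  rcases max_cases 0 (u + s) with ⟨h2, _⟩ | ⟨h2, _⟩ <;>
  rcases max_cases 0 (u + q) with ⟨h3, _⟩ | ⟨h3, _⟩ <;>
  rcases max_cases 0 u with ⟨h4, _⟩ | ⟨h4, _⟩ <;>
  rw [h1, h2, h3, h4] <;> nlinarith [mul_nonneg hs hq]

theorem sqPos_second_diff_le (u : ℝ) {s q : ℝ} (hs : 0 ≤ s) (hq : 0 ≤ q) :
    sqPos (u + s + q) - sqPos (u + s) - sqPos (u + q) + sqPos u ≤ 2 * s * q := by
  unfold sqPos
  rcases max_cases 0 (u + s + q) with ⟨h1, _⟩ | ⟨h1, _⟩ <;>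
  rcases max_cases 0 (u + s) with ⟨h2, _⟩ | ⟨h2, _⟩ <;>
  rcases max_cases 0 (u + q) with ⟨h3, _⟩ | ⟨h3, _⟩ <;>
  rcases max_cases 0 u with ⟨h4, _⟩ | ⟨h4, _⟩ <;>
  rw [h1, h2, h3, h4] <;> nlinarith [mul_nonneg hs hq]

theorem sqPos_second_diff_ge (u : ℝ) {s q : ℝ} (hs : |s| ≤ 1) (hq : |q| ≤ 1) :
    -2 ≤ sqPos (u + s + q) - sqPos (u + s) - sqPos (u + q) + sqPos u := by
  rw [abs_le] at hs hq
  rcases le_total 0 s with h | h <;> rcases le_total 0 q with h' | h'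
  · linarith [sqPos_second_diff_nonneg u h h']
  · have := sqPos_second_diff_le (u + q) h (neg_nonneg.2 h')
    rw [show u + q + s + -q = u + s by ring, show u + q + -q = u by ring,
      show u + q + s = u + s + q by ring] at this
    nlinarith
  · have := sqPos_second_diff_le (u + s) h' (neg_nonneg.2 h)
    rw [show u + s + q + -s = u + q by ring, show u + s + -s = u by ring] at this
    nlinarith
  · have := sqPos_second_diff_nonneg (u + s + q) (neg_nonneg.2 h) (neg_nonneg.2 h')
    rw [show u + s + q + -s + -q = u by ring, show u + s + q + -s = u + q by ring,
      show u + s + q + -q = u + s by ring] at this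
    linarith

theorem sqPos_second_diff_nonneg_of_nonpos (u : ℝ) {s q : ℝ} (hs : s ≤ 0) (hq : q ≤ 0) :
    0 ≤ sqPos (u + s + q) - sqPos (u + s) - sqPos (u + q) + sqPos u := by
  have := sqPos_second_diff_nonneg (u + s + q) (neg_nonneg.2 hs) (neg_nonneg.2 hq)
  rw [show u + s + q + -s + -q = u by ring, show u + s + q + -s = u + q by ring,
    show u + s + q + -q = u + s by ring] at this
  linarith

theorem sqPos_diff_le (u : ℝ) {s : ℝ} (hs : s ≤ 1) :
    sqPos (u + s) - sqPos u ≤ 2 * max 0 u + 1 := by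
  have h : sqPos (u + s) ≤ sqPos (u + 1) := sqPos_mono (by linarith)
  have h' : sqPos (u + 1) - sqPos u ≤ 2 * max 0 u + 1 := by
    unfold sqPos
    rcases max_cases 0 (u + 1) with ⟨h1, _⟩ | ⟨h1, _⟩ <;>
    rcases max_cases 0 u with ⟨h4, _⟩ | ⟨h4, _⟩ <;>
    rw [h1, h4] <;> nlinarith
  linarith

/-- The contribution of one summand `φ = (u⁺)²` to the mixed second difference of
`(1 - h)^x (1 + δ h² ∑ φ)`, up to the factor `δ h²`. It is bounded below by a constant whatever
the size of `u` is, because the first differences of `φ` are linear in `u⁺` and are absorbed by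
`h² φ`. It can be negative only if one of the two steps may be positive, as indicated by `I` and
`I'`. -/
theorem sqPos_step_bound (u : ℝ) {h s s' I I' : ℝ} (h0 : 0 ≤ h) (h1 : h ≤ 1)
    (hs : |s| ≤ 1) (hs' : |s'| ≤ 1) (hI : I = 1 ∨ I = 0 ∧ s ≤ 0) (hI' : I' = 1 ∨ I' = 0 ∧ s' ≤ 0) :
    -5 * (I + I') ≤ h ^ 2 * sqPos u
      - (1 - h) * h * ((sqPos (u + s) - sqPos u) + (sqPos (u + s') - sqPos u))
      + (1 - h) ^ 2 * (sqPos (u + s + s') - sqPos (u + s) - sqPos (u + s') + sqPos u) := by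
  have hv : 0 ≤ max 0 u := le_max_left _ _
  have hl : 0 ≤ 1 - h := by linarith
  have hsq : sqPos u = max 0 u ^ 2 := rfl
  have hh : 0 ≤ (1 - h) * h := mul_nonneg hl h0
  have hh1 : (1 - h) * h ≤ h := by nlinarith
  have hl2 : (1 - h) ^ 2 ≤ 1 := by nlinarith
  have hl2' : 0 ≤ (1 - h) ^ 2 := sq_nonneg _
  have d1 := sqPos_diff_le u (abs_le.1 hs).2
  have d2 := sqPos_diff_le u (abs_le.1 hs').2
  have d3 := sqPos_second_diff_ge u hs hs'
  have hw : 0 ≤ h * max 0 u := mul_nonneg h0 hv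
  have key : (1 - h) * h * (2 * max 0 u + 1) ≤ 2 * (h * max 0 u) + 1 := by
    calc (1 - h) * h * (2 * max 0 u + 1) ≤ h * (2 * max 0 u + 1) := by
          apply mul_le_mul_of_nonneg_right hh1; linarith
      _ ≤ _ := by linarith
  have e1 := mul_le_mul_of_nonneg_left d1 hh
  have e2 := mul_le_mul_of_nonneg_left d2 hh
  have e3 : -2 ≤ (1 - h) ^ 2 *
      (sqPos (u + s + s') - sqPos (u + s) - sqPos (u + s') + sqPos u) := by nlinarith
  have e4 : h ^ 2 * sqPos u = (h * max 0 u) ^ 2 := by rw [hsq]; ring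
  rcases hI with rfl | ⟨rfl, hI⟩ <;> rcases hI' with rfl | ⟨rfl, hI'⟩
  · nlinarith [sq_nonneg (h * max 0 u - 2)]
  · have e5 := mul_nonneg hh (sub_nonneg.2 (sqPos_mono (show u + s' ≤ u by linarith)))
    nlinarith [sq_nonneg (h * max 0 u - 1)]
  · have e5 := mul_nonneg hh (sub_nonneg.2 (sqPos_mono (show u + s ≤ u by linarith)))
    nlinarith [sq_nonneg (h * max 0 u - 1)]
  · have e5 := mul_nonneg hh (sub_nonneg.2 (sqPos_mono (show u + s' ≤ u by linarith)))
    have e6 := mul_nonneg hh (sub_nonneg.2 (sqPos_mono (show u + s ≤ u by linarith)))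
    have e7 := mul_nonneg hl2' (sqPos_second_diff_nonneg_of_nonpos u hI hI')
    nlinarith [sq_nonneg (h * max 0 u)]

/-! ### The layered instance -/

/-- The numerical parameters of the layered instance. The ground set is labelled by natural
numbers: the elements with a label `j ≤ r` form the layer `j`, and the elements with the label
`r + 1` form the hidden set that carries an optimal solution. The optimal solution has `K + j₀`
elements, `j₀` of which are given up to hide it. -/
structure LayerParams where
  /-- the last layer -/
  r : ℕ
  /-- the scale: a generic element covers the fraction `1 / K` of what is not yet covered -/
  K : ℕ
  /-- the number of hidden elements that behave like generic ones -/
  j₀ : ℕ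
  /-- the tolerated ratio of the counts in consecutive layers -/
  a : ℝ
  /-- the tolerated additive excess of a count -/
  slack : ℝ
  /-- the instance is truncated at `1 - τ` -/
  τ : ℝ
  K_pos : 0 < K
  a_nonneg : 0 ≤ a
  a_le_one : a ≤ 1
  slack_nonneg : 0 ≤ slack
  τ_nonneg : 0 ≤ τ
  τ_le_one : τ ≤ 1

namespace LayerParams

variable {E : Type} (P : LayerParams) (L : E → ℕ)

/-- The fraction that a generic element covers. -/
noncomputable def h : ℝ := 1 / P.K

/-- The number of elements of `S` in layer `j`. -/
def count (L : E → ℕ) (j : ℕ) (S : Finset E) : ℕ := (S.filter fun e => L e = j).card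

/-- The number of elements of `S` in the layer before layer `j`; it is zero for `j = 0`. -/
def prevCount (L : E → ℕ) (j : ℕ) (S : Finset E) : ℕ := (S.filter fun e => L e + 1 = j).card

/-- The imbalance of `S` between layer `j` and the layer before it. -/
noncomputable def imbalance (j : ℕ) (S : Finset E) : ℝ :=
  count L j S - P.a * prevCount L j S - P.slack

/-- The penalty for unbalanced sets, taken over the layers `j < i`. -/
noncomputable def penalty (i : ℕ) (S : Finset E) : ℝ :=
  ∑ j ∈ Finset.range i, sqPos (P.imbalance L j S)

/-- The factor by which the penalty increases the uncovered fraction. -/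
noncomputable def penaltyFactor (i : ℕ) (S : Finset E) : ℝ :=
  1 + P.h ^ 2 * P.penalty L i S / 16

/-- The fraction left uncovered by `j` hidden elements: geometric for `j ≤ j₀`, then linear. -/
noncomputable def tail (j : ℕ) : ℝ :=
  (1 - P.h) ^ min j P.j₀ * max 0 (1 - P.h * ((j - P.j₀ : ℕ) : ℝ))

/-- The fraction left uncovered by the elements of `S` outside the hidden set. -/
noncomputable def generic (S : Finset E) : ℝ :=
  (1 - P.h) ^ (S.filter fun e => L e ≠ P.r + 1).card * P.penaltyFactor L (P.r + 1) S

/-- The fraction left uncovered by `S`. -/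
noncomputable def uncovered (S : Finset E) : ℝ :=
  P.generic L S * P.tail (count L (P.r + 1) S)

/-- The layered instance. -/
noncomputable def value (S : Finset E) : ℝ := min (1 - P.uncovered L S) (1 - P.τ)

theorem h_pos : 0 < P.h := by
  have := P.K_pos
  unfold h; positivity

theorem h_le_one : P.h ≤ 1 := by
  have : (1 : ℝ) ≤ P.K := by exact_mod_cast P.K_pos
  unfold h
  rw [div_le_one (by linarith)]
  exact this

theorem penalty_nonneg (i : ℕ) (S : Finset E) : 0 ≤ P.penalty L i S :=
  Finset.sum_nonneg fun _ _ => sqPos_nonneg _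

theorem one_le_penaltyFactor (i : ℕ) (S : Finset E) : 1 ≤ P.penaltyFactor L i S := by
  have := P.penalty_nonneg L i S
  unfold penaltyFactor
  have : 0 ≤ P.h ^ 2 * P.penalty L i S / 16 := by positivity
  linarith

theorem generic_nonneg (S : Finset E) : 0 ≤ P.generic L S :=
  mul_nonneg (pow_nonneg (by linarith [P.h_le_one]) _)
    (by linarith [P.one_le_penaltyFactor L (P.r + 1) S])

theorem tail_nonneg (j : ℕ) : 0 ≤ P.tail j :=
  mul_nonneg (pow_nonneg (by linarith [P.h_le_one]) _) (le_max_left _ _)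

theorem tail_of_le {j : ℕ} (hj : j ≤ P.j₀) : P.tail j = (1 - P.h) ^ j := by
  simp [tail, min_eq_left hj, Nat.sub_eq_zero_of_le hj]

theorem tail_of_ge (m : ℕ) :
    P.tail (P.j₀ + m) = (1 - P.h) ^ P.j₀ * max 0 (1 - P.h * m) := by
  simp [tail]

theorem tail_succ_le (j : ℕ) : P.tail (j + 1) ≤ P.tail j := by
  have h0 := P.h_pos
  have h1 := P.h_le_one
  rcases Nat.lt_or_ge j P.j₀ with hj | hj
  · rw [P.tail_of_le hj, P.tail_of_le hj.le, pow_succ]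
    have : 0 ≤ (1 - P.h) ^ j := pow_nonneg (by linarith) _
    nlinarith
  · obtain ⟨m, rfl⟩ := Nat.exists_eq_add_of_le hj
    rw [add_assoc, P.tail_of_ge, P.tail_of_ge]
    refine mul_le_mul_of_nonneg_left (max_le_max_left _ ?_) (pow_nonneg (by linarith) _)
    push_cast
    linarith

theorem tail_le_one (j : ℕ) : P.tail j ≤ 1 := by
  induction j with
  | zero => rw [P.tail_of_le (Nat.zero_le _)]; simp
  | succ j ih => exact (P.tail_succ_le j).trans ih

theorem tail_convex (j : ℕ) : 0 ≤ P.tail j - 2 * P.tail (j + 1) + P.tail (j + 2) := by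
  have h0 := P.h_pos
  have h1 := P.h_le_one
  rcases Nat.lt_or_ge (j + 1) P.j₀ with hj | hj
  · rw [P.tail_of_le hj, P.tail_of_le hj.le, P.tail_of_le (by omega)]
    have : 0 ≤ (1 - P.h) ^ j := pow_nonneg (by linarith) _
    have e : (1 - P.h) ^ j - 2 * (1 - P.h) ^ (j + 1) + (1 - P.h) ^ (j + 2)
        = (1 - P.h) ^ j * P.h ^ 2 := by ring
    rw [e]; positivity
  rcases Nat.eq_or_lt_of_le hj with hj | hj
  · have h2 : P.tail (j + 2) = (1 - P.h) ^ (j + 1) * (1 - P.h) := by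
      have := P.tail_of_ge 1
      rw [hj] at this
      rw [this, Nat.cast_one, mul_one, max_eq_right (by linarith)]
    rw [h2, P.tail_of_le hj.ge, P.tail_of_le (by omega)]
    have : 0 ≤ (1 - P.h) ^ j := pow_nonneg (by linarith) _
    have e : (1 - P.h) ^ j - 2 * (1 - P.h) ^ (j + 1) + (1 - P.h) ^ (j + 1) * (1 - P.h)
        = (1 - P.h) ^ j * P.h ^ 2 := by ring
    rw [e]; positivity
  · obtain ⟨m, rfl⟩ := Nat.exists_eq_add_of_le (Nat.le_of_lt_succ hj)
    rw [add_assoc, add_assoc, P.tail_of_ge, P.tail_of_ge, P.tail_of_ge]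
    have hp : 0 ≤ (1 - P.h) ^ P.j₀ := pow_nonneg (by linarith) _
    have key : 0 ≤ max 0 (1 - P.h * m) - 2 * max 0 (1 - P.h * ((m + 1 : ℕ) : ℝ))
        + max 0 (1 - P.h * ((m + 2 : ℕ) : ℝ)) := by
      push_cast
      rcases max_cases 0 (1 - P.h * (m + 1 : ℝ)) with ⟨e, _⟩ | ⟨e, _⟩ <;> rw [e]
      · have := le_max_left 0 (1 - P.h * (m : ℝ))
        have := le_max_left 0 (1 - P.h * (m + 2 : ℝ))
        linarith
      · have := le_max_right 0 (1 - P.h * (m : ℝ))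
        have := le_max_right 0 (1 - P.h * (m + 2 : ℝ))
        linarith
    nlinarith [mul_nonneg hp key]

theorem tail_eq_zero : P.tail (P.K + P.j₀) = 0 := by
  have : (0 : ℝ) < P.K := by exact_mod_cast P.K_pos
  rw [add_comm, P.tail_of_ge, h, one_div_mul_cancel this.ne']
  simp

/-! ### Submodularity of the layered instance -/

/-- The change of the imbalance in layer `j` when an element `e` is added. -/
noncomputable def imbalanceStep (j : ℕ) (e : E) : ℝ :=
  (if L e = j then 1 else 0) - P.a * (if L e + 1 = j then 1 else 0)

theorem imbalance_insert [DecidableEq E] {S : Finset E} {e : E} (he : e ∉ S) (j : ℕ) :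
    P.imbalance L j (insert e S) = P.imbalance L j S + P.imbalanceStep L j e := by
  unfold imbalance imbalanceStep count prevCount
  have h1 : ∀ p : E → Prop, [DecidablePred p] → e ∉ S.filter p := fun p _ hx =>
    he (Finset.mem_of_mem_filter e hx)
  rw [Finset.filter_insert, Finset.filter_insert]
  split_ifs with h2 h3 h3
  · omega
  · rw [Finset.card_insert_of_notMem (h1 _)]; push_cast; ring
  · rw [Finset.card_insert_of_notMem (h1 _)]; push_cast; ring
  · ring

theorem abs_imbalanceStep_le (j : ℕ) (e : E) : |P.imbalanceStep L j e| ≤ 1 := by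
  have := P.a_nonneg
  have := P.a_le_one
  unfold imbalanceStep
  rw [abs_le]
  split_ifs <;> constructor <;> first | omega | linarith

theorem imbalanceStep_sign (j : ℕ) (e : E) :
    (if L e = j then (1 : ℝ) else 0) = 1 ∨
      (if L e = j then (1 : ℝ) else 0) = 0 ∧ P.imbalanceStep L j e ≤ 0 := by
  have := P.a_nonneg
  unfold imbalanceStep
  split_ifs <;> simp
  linarith

theorem sum_layer_indicator_le (i : ℕ) (e : E) :
    ∑ j ∈ Finset.range i, (if L e = j then (1 : ℝ) else 0) ≤ 1 := by
  rw [Finset.sum_ite_eq]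
  split_ifs <;> norm_num

/-- The mixed second difference of `(1 - h)^x * penaltyFactor`, divided by `(1 - h)^x`. By
`sqPos_step_bound` the summands of the penalty contribute at least `-10 h² / 16`, which is paid for
by the second difference `h²` of `(1 - h)^x` alone. -/
theorem penaltyFactor_second_diff [DecidableEq E] (i : ℕ) {S : Finset E} {e e' : E} (he : e ∉ S) (he' : e' ∉ S)
    (hne : e ≠ e') :
    0 ≤ P.penaltyFactor L i S - (1 - P.h) * P.penaltyFactor L i (insert e S)
      - (1 - P.h) * P.penaltyFactor L i (insert e' S)
      + (1 - P.h) ^ 2 * P.penaltyFactor L i (insert e (insert e' S)) := by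
  have hb : ∀ j ∈ Finset.range i, -5 * ((if L e = j then (1 : ℝ) else 0)
        + (if L e' = j then (1 : ℝ) else 0)) ≤
      P.h ^ 2 * sqPos (P.imbalance L j S) - (1 - P.h) * P.h *
        ((sqPos (P.imbalance L j (insert e S)) - sqPos (P.imbalance L j S))
          + (sqPos (P.imbalance L j (insert e' S)) - sqPos (P.imbalance L j S)))
      + (1 - P.h) ^ 2 * (sqPos (P.imbalance L j (insert e (insert e' S)))
          - sqPos (P.imbalance L j (insert e S)) - sqPos (P.imbalance L j (insert e' S))
          + sqPos (P.imbalance L j S)) := by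
    intro j _
    have he2 : e ∉ insert e' S := by simp [hne, he]
    rw [P.imbalance_insert L he, P.imbalance_insert L he2, P.imbalance_insert L he',
      add_right_comm]
    exact sqPos_step_bound _ P.h_pos.le P.h_le_one (P.abs_imbalanceStep_le L j e)
      (P.abs_imbalanceStep_le L j e') (P.imbalanceStep_sign L j e) (P.imbalanceStep_sign L j e')
  have hs := Finset.sum_le_sum hb
  simp only [← Finset.mul_sum, Finset.sum_add_distrib, Finset.sum_sub_distrib] at hs
  have h1 := sum_layer_indicator_le L i e
  have h2 := sum_layer_indicator_le L i e'
  have hp := sq_nonneg P.h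
  unfold penaltyFactor penalty
  set A := ∑ j ∈ Finset.range i, sqPos (P.imbalance L j S)
  set B := ∑ j ∈ Finset.range i, sqPos (P.imbalance L j (insert e S))
  set C := ∑ j ∈ Finset.range i, sqPos (P.imbalance L j (insert e' S))
  set D := ∑ j ∈ Finset.range i, sqPos (P.imbalance L j (insert e (insert e' S)))
  have h3 : -10 ≤ P.h ^ 2 * A - (1 - P.h) * P.h * (B - A + (C - A))
      + (1 - P.h) ^ 2 * (D - B - C + A) := by linarith
  have h4 := mul_nonneg hp (show 0 ≤ 1 + (P.h ^ 2 * A - (1 - P.h) * P.h * (B - A + (C - A))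
      + (1 - P.h) ^ 2 * (D - B - C + A)) / 16 by linarith)
  linarith

theorem penaltyFactor_insert_le [DecidableEq E] (i : ℕ) {S : Finset E} {e : E} (he : e ∉ S) :
    (1 - P.h) * P.penaltyFactor L i (insert e S) ≤ P.penaltyFactor L i S := by
  have h0 := P.h_pos
  have h1 := P.h_le_one
  have hb : ∀ j ∈ Finset.range i, P.h ^ 2 * ((1 - P.h) * sqPos (P.imbalance L j (insert e S))
      - sqPos (P.imbalance L j S)) ≤ P.h * 2 * (if L e = j then (1 : ℝ) else 0) := by
    intro j _
    rw [P.imbalance_insert L he]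
    have hs := P.abs_imbalanceStep_le L j e
    set u := P.imbalance L j S
    set s := P.imbalanceStep L j e
    have hsq : sqPos u = max 0 u ^ 2 := rfl
    have hl : 0 ≤ 1 - P.h := by linarith
    rcases P.imbalanceStep_sign L j e with hI | ⟨hI, hI'⟩ <;> rw [hI]
    · have d := sqPos_diff_le u (abs_le.1 hs).2
      have hv : 0 ≤ max 0 u := le_max_left _ _
      have d1 := mul_le_mul_of_nonneg_left d hl
      have d2 : P.h * ((1 - P.h) * sqPos (u + s) - sqPos u) ≤ 2 := by
        have : P.h * ((1 - P.h) * sqPos (u + s) - sqPos u) ≤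
            P.h * ((1 - P.h) * (2 * max 0 u + 1) - P.h * max 0 u ^ 2) := by
          apply mul_le_mul_of_nonneg_left _ h0.le
          rw [← hsq]; linarith
        have h3 : P.h * ((1 - P.h) * (2 * max 0 u + 1)) ≤ P.h * (2 * max 0 u + 1) := by
          apply mul_le_mul_of_nonneg_left _ h0.le
          nlinarith
        nlinarith [sq_nonneg (P.h * max 0 u - 1)]
      nlinarith
    · have d : sqPos (u + s) ≤ sqPos u := sqPos_mono (by linarith)
      have := sqPos_nonneg (u + s)
      have d2 : (1 - P.h) * sqPos (u + s) - sqPos u ≤ 0 := by nlinarith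
      nlinarith [sq_nonneg P.h]
  have hs := Finset.sum_le_sum hb
  simp only [← Finset.mul_sum, Finset.sum_sub_distrib] at hs
  have h2 := sum_layer_indicator_le L i e
  unfold penaltyFactor penalty
  nlinarith

theorem count_insert_of_ne [DecidableEq E] {S : Finset E} {e : E} {j : ℕ} (h : L e ≠ j) :
    count L j (insert e S) = count L j S := by
  rw [count, Finset.filter_insert, if_neg h, count]

theorem count_insert_of_eq [DecidableEq E] {S : Finset E} {e : E} {j : ℕ} (he : e ∉ S) (h : L e = j) :
    count L j (insert e S) = count L j S + 1 := by
  rw [count, Finset.filter_insert, if_pos h,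
    Finset.card_insert_of_notMem (fun hx => he (Finset.mem_of_mem_filter e hx)), count]

theorem generic_insert_of_ne [DecidableEq E] {S : Finset E} {e : E} (he : e ∉ S) (h : L e ≠ P.r + 1) :
    P.generic L (insert e S) = (1 - P.h) ^ (S.filter fun e => L e ≠ P.r + 1).card *
      ((1 - P.h) * P.penaltyFactor L (P.r + 1) (insert e S)) := by
  rw [generic, Finset.filter_insert, if_pos h,
    Finset.card_insert_of_notMem (fun hx => he (Finset.mem_of_mem_filter e hx)), pow_succ]
  ring

theorem generic_insert_of_eq [DecidableEq E] {S : Finset E} {e : E} (he : e ∉ S) (h : L e = P.r + 1) :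
    P.generic L (insert e S) = P.generic L S := by
  have hp : P.penalty L (P.r + 1) (insert e S) = P.penalty L (P.r + 1) S := by
    refine Finset.sum_congr rfl fun j hj => ?_
    rw [Finset.mem_range] at hj
    rw [P.imbalance_insert L he, imbalanceStep, if_neg (by omega), if_neg (by omega)]
    simp
  rw [generic, Finset.filter_insert, if_neg (by simpa using h), penaltyFactor, hp, generic,
    penaltyFactor]

theorem generic_insert_le [DecidableEq E] {S : Finset E} {e : E} (he : e ∉ S) :
    P.generic L (insert e S) ≤ P.generic L S := by
  by_cases h : L e = P.r + 1
  · rw [P.generic_insert_of_eq L he h]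
  · rw [P.generic_insert_of_ne L he h]
    exact mul_le_mul_of_nonneg_left (P.penaltyFactor_insert_le L _ he)
      (pow_nonneg (by linarith [P.h_le_one]) _)

theorem uncovered_insert_le [DecidableEq E] {S : Finset E} {e : E} (he : e ∉ S) :
    P.uncovered L (insert e S) ≤ P.uncovered L S := by
  unfold uncovered
  refine mul_le_mul (P.generic_insert_le L he) ?_ (P.tail_nonneg _) (P.generic_nonneg L S)
  by_cases h : L e = P.r + 1
  · rw [count_insert_of_eq L he h]
    exact P.tail_succ_le _
  · rw [count_insert_of_ne L h]

theorem uncovered_second_diff [DecidableEq E] {S : Finset E} {e e' : E} (he : e ∉ S) (he' : e' ∉ S)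
    (hne : e ≠ e') :
    P.uncovered L (insert e S) + P.uncovered L (insert e' S) ≤
      P.uncovered L (insert e (insert e' S)) + P.uncovered L S := by
  have he2 : e ∉ insert e' S := by simp [hne, he]
  have he2' : e' ∉ insert e S := by simp [hne.symm, he']
  unfold uncovered
  by_cases h : L e = P.r + 1 <;> by_cases h' : L e' = P.r + 1
  · rw [P.generic_insert_of_eq L he2 h, P.generic_insert_of_eq L he h,
      P.generic_insert_of_eq L he' h', count_insert_of_eq L he2 h, count_insert_of_eq L he h,
      count_insert_of_eq L he' h']
    have := mul_nonneg (P.generic_nonneg L S) (P.tail_convex (count L (P.r + 1) S))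
    linarith
  · rw [P.generic_insert_of_eq L he2 h, P.generic_insert_of_eq L he h,
      count_insert_of_eq L he2 h, count_insert_of_eq L he h, count_insert_of_ne L h']
    have := mul_nonneg (sub_nonneg.2 (P.generic_insert_le L he'))
      (sub_nonneg.2 (P.tail_succ_le (count L (P.r + 1) S)))
    linarith
  · rw [Finset.insert_comm, P.generic_insert_of_eq L he2' h', P.generic_insert_of_eq L he' h',
      count_insert_of_eq L he2' h', count_insert_of_eq L he' h', count_insert_of_ne L h]
    have := mul_nonneg (sub_nonneg.2 (P.generic_insert_le L he))
      (sub_nonneg.2 (P.tail_succ_le (count L (P.r + 1) S)))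
    linarith
  · rw [count_insert_of_ne L h, count_insert_of_ne L h, count_insert_of_ne L h',
      ← add_mul, ← add_mul]
    refine mul_le_mul_of_nonneg_right ?_ (P.tail_nonneg _)
    have hc : ((insert e' S).filter fun e => L e ≠ P.r + 1).card =
        (S.filter fun e => L e ≠ P.r + 1).card + 1 := by
      rw [Finset.filter_insert, if_pos h',
        Finset.card_insert_of_notMem (fun hx => he' (Finset.mem_of_mem_filter e' hx))]
    rw [P.generic_insert_of_ne L he2 h, P.generic_insert_of_ne L he h,
      P.generic_insert_of_ne L he' h', hc, generic, pow_succ]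
    have := mul_nonneg (pow_nonneg (show 0 ≤ 1 - P.h by linarith [P.h_le_one])
      (S.filter fun e => L e ≠ P.r + 1).card)
      (P.penaltyFactor_second_diff L (P.r + 1) he he' hne)
    linarith

theorem uncovered_empty : P.uncovered L ∅ = 1 := by
  have h : ∀ j, sqPos (P.imbalance L j ∅) = 0 := by
    intro j
    have := P.slack_nonneg
    simp [imbalance, count, prevCount, sqPos, this]
  simp [uncovered, generic, penaltyFactor, penalty, h, count, P.tail_of_le]

theorem value_isMonotoneSubmodular [DecidableEq E] : IsMonotoneSubmodular (P.value L) := by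
  have h : IsMonotoneSubmodular fun S : Finset E => 1 - P.uncovered L S := by
    refine ⟨?_, ?_, ?_⟩
    · simp [P.uncovered_empty L]
    · refine Finset.monotone_iff_forall_le_insert.2 fun S e he => ?_
      linarith [P.uncovered_insert_le L he]
    · refine submodular_of_insert_insert (f := fun S : Finset E => 1 - P.uncovered L S)
        fun S e he e' he' hne => ?_
      linarith [P.uncovered_second_diff L he he' hne]
  exact h.min_const (by linarith [P.τ_le_one])

theorem uncovered_nonneg (S : Finset E) : 0 ≤ P.uncovered L S :=
  mul_nonneg (P.generic_nonneg L S) (P.tail_nonneg _)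

theorem value_le_one (S : Finset E) : P.value L S ≤ 1 :=
  (min_le_left _ _).trans (by linarith [P.uncovered_nonneg L S])

/-- If the hidden set has at least `K + j₀` elements, then that many elements of it are an optimal
solution. -/
theorem optValue_value [Fintype E] (hL : P.K + P.j₀ ≤ count L (P.r + 1) Finset.univ) :
    optValue (P.value L) (P.K + P.j₀) = 1 - P.τ := by
  unfold optValue
  apply le_antisymm
  · exact Finset.sup'_le _ _ fun S _ => min_le_right _ _
  · obtain ⟨S, hS, hcard⟩ := Finset.exists_subset_card_eq hL
    have hc : count L (P.r + 1) S = P.K + P.j₀ := by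
      rw [count, Finset.filter_true_of_mem, hcard]
      exact fun e he => (Finset.mem_filter.1 (hS he)).2
    have hv : P.value L S = 1 - P.τ := by
      rw [value, uncovered, hc, P.tail_eq_zero, mul_zero, sub_zero, min_eq_right]
      linarith [P.τ_nonneg]
    rw [← hv]
    exact Finset.le_sup' (P.value L) (by simp [hcard])

/-! ### Balanced sets do not reveal later layers -/

theorem sum_count (i : ℕ) (S : Finset E) :
    ∑ j ∈ Finset.range i, count L j S = (S.filter fun e => L e < i).card := by
  rw [Finset.card_eq_sum_card_fiberwise (f := L) (t := Finset.range i)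
    (fun e he => by simpa using (Finset.mem_filter.1 he).2)]
  refine Finset.sum_congr rfl fun j hj => ?_
  rw [count, Finset.filter_filter]
  congr 1
  refine Finset.filter_congr fun e _ => ?_
  rw [Finset.mem_range] at hj
  omega

theorem card_filter_add_count (S : Finset E) :
    (S.filter fun e => L e ≠ P.r + 1).card + count L (P.r + 1) S = S.card := by
  rw [add_comm]
  exact Finset.card_filter_add_card_filter_not _

theorem penalty_le (S : Finset E) :
    P.penalty L (P.r + 1) S ≤ ((S.filter fun e => L e ≠ P.r + 1).card : ℝ) ^ 2 := by
  set x := (S.filter fun e => L e ≠ P.r + 1).card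
  have hsum : ∑ j ∈ Finset.range (P.r + 1), count L j S ≤ x := by
    rw [sum_count]
    refine Finset.card_le_card fun e he => ?_
    rw [Finset.mem_filter] at he ⊢
    exact ⟨he.1, he.2.ne⟩
  have hle : ∀ j ∈ Finset.range (P.r + 1), sqPos (P.imbalance L j S) ≤ (count L j S : ℝ) * x := by
    intro j hj
    have h1 : count L j S ≤ x := (Finset.single_le_sum (f := fun j => count L j S)
      (fun _ _ => Nat.zero_le _) hj).trans hsum
    have h2 : max 0 (P.imbalance L j S) ≤ count L j S := by
      refine max_le (Nat.cast_nonneg _) ?_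
      have := mul_nonneg P.a_nonneg (Nat.cast_nonneg (α := ℝ) (prevCount L j S))
      have := P.slack_nonneg
      unfold imbalance
      linarith
    have h3 : (count L j S : ℝ) ≤ x := by exact_mod_cast h1
    have h4 : 0 ≤ max 0 (P.imbalance L j S) := le_max_left _ _
    unfold sqPos
    nlinarith
  have hsum' : (∑ j ∈ Finset.range (P.r + 1), (count L j S : ℝ)) ≤ x := by exact_mod_cast hsum
  calc P.penalty L (P.r + 1) S ≤ ∑ j ∈ Finset.range (P.r + 1), (count L j S : ℝ) * x :=
        Finset.sum_le_sum hle
    _ = (∑ j ∈ Finset.range (P.r + 1), (count L j S : ℝ)) * x := by rw [Finset.sum_mul]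
    _ ≤ x * x := mul_le_mul_of_nonneg_right hsum' (Nat.cast_nonneg _)
    _ = (x : ℝ) ^ 2 := by ring

/-- The elements of `S` outside the layers `j < i`. -/
def late (L : E → ℕ) (i : ℕ) (S : Finset E) : Finset E := S.filter fun e => i ≤ L e

/-- The set `S` looks, from layer `i` on, like a random set: the layer counts decrease and few
elements are hidden ones. -/
structure Balanced (q Λ : ℝ) (i : ℕ) (S : Finset E) : Prop where
  decreasing : ∀ j, i ≤ j → j < P.r → (count L (j + 1) S : ℝ) ≤ P.a * count L j S + P.slack
  hidden : (count L (P.r + 1) S : ℝ) ≤ 2 * q * (late L i S).card + Λ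

/-- The value of a set that is balanced from layer `i` on. It depends on the labels up to `i`
only, see `stageValue_congr`. -/
noncomputable def stageValue (T₀ : ℝ) (i : ℕ) (S : Finset E) : ℝ :=
  if ((late L i S).card : ℝ) ≤ T₀ then
    min (1 - (1 - P.h) ^ S.card * P.penaltyFactor L (i + 1) S) (1 - P.τ)
  else 1 - P.τ

theorem stageValue_congr (T₀ : ℝ) {L L' : E → ℕ} {i : ℕ}
    (h : ∀ e, min (L e) (i + 1) = min (L' e) (i + 1)) (S : Finset E) :
    P.stageValue L T₀ i S = P.stageValue L' T₀ i S := by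
  have h1 : late L i S = late L' i S :=
    Finset.filter_congr fun e _ => by have := h e; omega
  have h2 : P.penalty L (i + 1) S = P.penalty L' (i + 1) S := by
    refine Finset.sum_congr rfl fun j hj => ?_
    rw [Finset.mem_range] at hj
    have h3 : count L j S = count L' j S := by
      unfold count
      congr 1
      exact Finset.filter_congr fun e _ => by have := h e; omega
    have h4 : prevCount L j S = prevCount L' j S := by
      unfold prevCount
      congr 1
      exact Finset.filter_congr fun e _ => by have := h e; omega
    rw [imbalance, imbalance, h3, h4]
  rw [stageValue, stageValue, h1, penaltyFactor, penaltyFactor, h2]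

variable {P L}

theorem Balanced.penalty_eq {q Λ : ℝ} {i : ℕ} {S : Finset E} (hB : P.Balanced L q Λ i S)
    (hi : i ≤ P.r) : P.penalty L (P.r + 1) S = P.penalty L (i + 1) S := by
  symm
  refine Finset.sum_subset (Finset.range_subset_range.2 (by omega)) fun j hj hj' => ?_
  rw [Finset.mem_range] at hj hj'
  obtain ⟨m, rfl⟩ : ∃ m, j = m + 1 := ⟨j - 1, by omega⟩
  have h1 := hB.decreasing m (by omega) (by omega)
  have h2 : prevCount L (m + 1) S = count L m S := by
    unfold prevCount count
    congr 1
    exact Finset.filter_congr fun e _ => by omega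
  have h3 : P.imbalance L (m + 1) S ≤ 0 := by
    rw [imbalance, h2]; linarith
  simp [sqPos, max_eq_left h3]

/-- A balanced set with few hidden elements has the same value as if the hidden elements were
generic ones. -/
theorem Balanced.uncovered_eq {q Λ : ℝ} {i : ℕ} {S : Finset E} (hB : P.Balanced L q Λ i S)
    (hi : i ≤ P.r) (hj : count L (P.r + 1) S ≤ P.j₀) :
    P.uncovered L S = (1 - P.h) ^ S.card * P.penaltyFactor L (i + 1) S := by
  rw [uncovered, generic, P.tail_of_le hj, penaltyFactor, hB.penalty_eq hi, penaltyFactor,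
    ← P.card_filter_add_count L S, pow_add]
  ring

/-- A set with many elements outside the hidden set has the maximal value. -/
theorem uncovered_le_of_large {T₀ : ℝ} {S : Finset E} (hτ : 24 * P.K ≤ P.τ * T₀)
    (hx : T₀ ≤ 2 * (S.filter fun e => L e ≠ P.r + 1).card) : P.uncovered L S ≤ P.τ := by
  have hK : (0 : ℝ) < P.K := by exact_mod_cast P.K_pos
  have hp := P.penalty_le L S
  have hg := P.generic_nonneg L S
  have ht := P.tail_le_one (count L (P.r + 1) S)
  have h0 := P.h_pos
  have h1 := P.h_le_one
  have hτ0 := P.τ_nonneg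
  have hτ1 := P.τ_le_one
  set x := (S.filter fun e => L e ≠ P.r + 1).card with hxdef
  have hT : 0 < T₀ := by
    by_contra hneg
    have := mul_nonneg hτ0 (neg_nonneg.2 (not_lt.1 hneg))
    linarith
  set z : ℝ := P.h * x with hz
  have hz0 : 12 ≤ P.τ * z := by
    have h2 : P.h * P.K = 1 := by unfold h; field_simp
    have h3 : P.τ * T₀ ≤ P.τ * (2 * x) := mul_le_mul_of_nonneg_left hx hτ0
    have h4 : P.h * (24 * P.K) ≤ P.h * (P.τ * (2 * x)) :=
      mul_le_mul_of_nonneg_left (hτ.trans h3) h0.le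
    rw [hz]; nlinarith
  have hz1 : 12 ≤ z := by
    have hzn : 0 ≤ z := by positivity
    nlinarith
  -- a cubic lower bound for the exponential beats the quadratic growth of the penalty
  have hexp : z ^ 3 / 6 ≤ Real.exp z := by
    have := Real.pow_div_factorial_le_exp z (by linarith) 3
    simpa [Nat.factorial] using this
  have hpow : (1 - P.h) ^ x ≤ Real.exp (-z) := by
    have h2 : 1 - P.h ≤ Real.exp (-P.h) := by linarith [Real.add_one_le_exp (-P.h)]
    calc (1 - P.h) ^ x ≤ Real.exp (-P.h) ^ x := pow_le_pow_left₀ (by linarith) h2 _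
      _ = Real.exp (-z) := by rw [← Real.exp_nat_mul, hz]; congr 1; ring
  have hf : P.penaltyFactor L (P.r + 1) S ≤ 2 * z ^ 2 := by
    have h2 : P.h ^ 2 * P.penalty L (P.r + 1) S ≤ P.h ^ 2 * (x : ℝ) ^ 2 :=
      mul_le_mul_of_nonneg_left hp (sq_nonneg _)
    have h3 : P.h ^ 2 * (x : ℝ) ^ 2 = z ^ 2 := by rw [hz]; ring
    unfold penaltyFactor
    nlinarith
  have hgen : P.generic L S ≤ Real.exp (-z) * (2 * z ^ 2) := by
    unfold generic
    exact mul_le_mul hpow hf (by linarith [P.one_le_penaltyFactor L (P.r + 1) S])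
      (Real.exp_pos _).le
  calc P.uncovered L S ≤ P.generic L S * 1 := mul_le_mul_of_nonneg_left ht hg
    _ ≤ Real.exp (-z) * (2 * z ^ 2) := by linarith
    _ ≤ P.τ := by
      rw [Real.exp_neg, inv_mul_le_iff₀ (Real.exp_pos _)]
      have h5 : z ^ 3 / 6 * P.τ ≤ Real.exp z * P.τ := mul_le_mul_of_nonneg_right hexp hτ0
      have h6 : z ^ 2 * 12 ≤ z ^ 2 * (P.τ * z) := mul_le_mul_of_nonneg_left hz0 (sq_nonneg _)
      nlinarith

/-- On sets that are balanced from layer `i` on, the instance agrees with a function that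
does not depend on the partition of the later layers. -/
theorem Balanced.value_eq {q Λ T₀ : ℝ} {i : ℕ} {S : Finset E} (hB : P.Balanced L q Λ i S)
    (hi : i ≤ P.r) (hq0 : 0 ≤ q) (hq : q ≤ 1 / 8) (hΛ : 4 * Λ ≤ T₀) (hj : 2 * q * T₀ + Λ ≤ P.j₀)
    (hτ : 24 * P.K ≤ P.τ * T₀) : P.value L S = P.stageValue L T₀ i S := by
  unfold stageValue
  split_ifs with h
  · have h1 : (count L (P.r + 1) S : ℝ) ≤ P.j₀ := by
      have := hB.hidden
      have : 2 * q * (late L i S).card ≤ 2 * q * T₀ := mul_le_mul_of_nonneg_left h (by linarith)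
      linarith
    rw [value, hB.uncovered_eq hi (by exact_mod_cast h1)]
  · rw [value, min_eq_right]
    have h1 : P.uncovered L S ≤ P.τ := by
      refine uncovered_le_of_large hτ ?_
      have h2 := hB.hidden
      have h3 : ((late L i S).card : ℝ) ≤ (S.filter fun e => L e ≠ P.r + 1).card
          + count L (P.r + 1) S := by
        have := Finset.card_filter_le S fun e => i ≤ L e
        rw [← P.card_filter_add_count L S] at this
        exact_mod_cast this
      have h4 : 2 * q * (late L i S).card ≤ 1 / 4 * (late L i S).card :=
        mul_le_mul_of_nonneg_right (by linarith) (Nat.cast_nonneg _)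
      linarith
    linarith

/-- The penalty is large on every set with many elements in the layers: up to the slack, the
imbalances of all layers add up to at least the fraction `1 - a` of the size. -/
theorem penalty_ge {S : Finset E} {x : ℝ} (hx : x ≤ ∑ j ∈ Finset.range (P.r + 1), (count L j S : ℝ))
    (hs : 2 * (P.r + 1) * P.slack ≤ (1 - P.a) * x) (hx0 : 0 ≤ x) :
    (1 - P.a) ^ 2 * x ^ 2 / (4 * (P.r + 1)) ≤ P.penalty L (P.r + 1) S := by
  have hcs := sq_sum_le_card_mul_sum_sq (s := Finset.range (P.r + 1))
    (f := fun j => max 0 (P.imbalance L j S))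
  have hprev : ∑ j ∈ Finset.range (P.r + 1), (prevCount L j S : ℝ) ≤
      ∑ j ∈ Finset.range (P.r + 1), (count L j S : ℝ) := by
    rw [Finset.sum_range_succ', Finset.sum_range_succ]
    have h0 : prevCount L 0 S = 0 := by simp [prevCount]
    have h1 : ∀ j, prevCount L (j + 1) S = count L j S := by
      intro j
      unfold prevCount count
      congr 1
      exact Finset.filter_congr fun e _ => by omega
    simp only [h0, h1]
    have : (0 : ℝ) ≤ count L P.r S := Nat.cast_nonneg _
    push_cast
    linarith
  have hsum : (1 - P.a) * x / 2 ≤ ∑ j ∈ Finset.range (P.r + 1), max 0 (P.imbalance L j S) := by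
    have h1 : ∑ j ∈ Finset.range (P.r + 1), P.imbalance L j S ≤
        ∑ j ∈ Finset.range (P.r + 1), max 0 (P.imbalance L j S) :=
      Finset.sum_le_sum fun _ _ => le_max_right _ _
    have h2 : ∑ j ∈ Finset.range (P.r + 1), P.imbalance L j S =
        ∑ j ∈ Finset.range (P.r + 1), (count L j S : ℝ)
          - P.a * ∑ j ∈ Finset.range (P.r + 1), (prevCount L j S : ℝ) - (P.r + 1) * P.slack := by
      unfold imbalance
      rw [Finset.sum_sub_distrib, Finset.sum_sub_distrib, ← Finset.mul_sum]
      simp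
    have h3 := mul_le_mul_of_nonneg_left hprev P.a_nonneg
    have h4 := mul_le_mul_of_nonneg_left hx (sub_nonneg.2 P.a_le_one)
    linarith
  have h0 : 0 ≤ (1 - P.a) * x / 2 := by
    have := mul_nonneg (sub_nonneg.2 P.a_le_one) hx0
    linarith
  have hr : (0 : ℝ) < P.r + 1 := by positivity
  rw [div_le_iff₀ (by positivity)]
  have h5 := pow_le_pow_left₀ h0 hsum 2
  simp only [Finset.card_range] at hcs
  push_cast at hcs
  have h6 : P.penalty L (P.r + 1) S =
    ∑ j ∈ Finset.range (P.r + 1), max 0 (P.imbalance L j S) ^ 2 := rfl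
  rw [h6]
  linarith

/-- The value of a feasible set that is balanced with respect to the hidden set. -/
theorem Balanced.value_le {q Λ : ℝ} {S : Finset E} (hB : P.Balanced L q Λ P.r S)
    (hL : ∀ e, L e ≤ P.r + 1) (hS : S.card = P.K + P.j₀) (hq : 0 ≤ q)
    (hj : 2 * q * (P.K + P.j₀) + Λ ≤ P.j₀) (hs : 2 * (P.r + 1) * P.slack ≤ (1 - P.a) * P.K) :
    P.value L S ≤ 1 - (1 - P.h) ^ (P.K + P.j₀) * (1 + (1 - P.a) ^ 2 / (64 * (P.r + 1))) := by
  have hK : (0 : ℝ) < P.K := by exact_mod_cast P.K_pos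
  have hc : count L (P.r + 1) S ≤ P.j₀ := by
    have h1 := hB.hidden
    have h2 : ((late L P.r S).card : ℝ) ≤ P.K + P.j₀ := by
      have := Finset.card_filter_le S fun e => P.r ≤ L e
      rw [hS] at this
      exact_mod_cast this
    have h3 := mul_le_mul_of_nonneg_left h2 (show 0 ≤ 2 * q by linarith)
    have : (count L (P.r + 1) S : ℝ) ≤ P.j₀ := by linarith
    exact_mod_cast this
  have hx : (P.K : ℝ) ≤ ∑ j ∈ Finset.range (P.r + 1), (count L j S : ℝ) := by
    have h1 := sum_count L (P.r + 1) S
    have h2 := P.card_filter_add_count L S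
    have h3 : (S.filter fun e => L e < P.r + 1) = S.filter fun e => L e ≠ P.r + 1 :=
      Finset.filter_congr fun e _ => by have := hL e; omega
    rw [h3] at h1
    have : P.K ≤ ∑ j ∈ Finset.range (P.r + 1), count L j S := by omega
    exact_mod_cast this
  have hp := penalty_ge hx hs hK.le
  refine (min_le_left _ _).trans ?_
  rw [hB.uncovered_eq le_rfl hc, hS, penaltyFactor]
  have hpow : 0 ≤ (1 - P.h) ^ (P.K + P.j₀) := pow_nonneg (by linarith [P.h_le_one]) _
  have h4 : (1 - P.a) ^ 2 / (64 * (P.r + 1)) ≤ P.h ^ 2 * P.penalty L (P.r + 1) S / 16 := by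
    have h5 := mul_le_mul_of_nonneg_left hp (sq_nonneg P.h)
    have h6 : P.h ^ 2 * ((1 - P.a) ^ 2 * (P.K : ℝ) ^ 2 / (4 * (P.r + 1))) =
        (1 - P.a) ^ 2 / (4 * (P.r + 1)) := by
      unfold h; field_simp
    have h7 : (1 - P.a) ^ 2 / (64 * (P.r + 1)) = (1 - P.a) ^ 2 / (4 * (P.r + 1)) / 16 := by
      rw [div_div]; congr 1; ring
    rw [h7]; linarith
  have := mul_le_mul_of_nonneg_left h4 hpow
  linarith

/-! ### The run of an algorithm against the layered instance -/

section Run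

variable {k m : ℕ}

variable (P L) in
/-- The history of an algorithm whose queries in round `i` are answered by `stageValue`. -/
noncomputable def stageHistory (A : AdaptiveAlgorithm E k m) (T₀ : ℝ) : ℕ → List (Fin m → ℝ)
  | 0 => []
  | i + 1 => stageHistory A T₀ i ++
      [fun j => P.stageValue L T₀ i (A.query (stageHistory A T₀ i) j)]

/-- Before round `i` the algorithm knows the layers `j < i` at most. -/
theorem stageHistory_congr (A : AdaptiveAlgorithm E k m) (T₀ : ℝ) {L L' : E → ℕ} {i : ℕ}
    (h : ∀ e, min (L e) i = min (L' e) i) :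
    P.stageHistory L A T₀ i = P.stageHistory L' A T₀ i := by
  induction i with
  | zero => rfl
  | succ i ih =>
    have h1 := ih fun e => by have := h e; omega
    rw [stageHistory, stageHistory, h1]
    simp only [P.stageValue_congr T₀ h]

theorem history_eq_stageHistory (A : AdaptiveAlgorithm E k m) (T₀ : ℝ) {i : ℕ}
    (h : ∀ i' < i, ∀ j, P.value L (A.query (P.stageHistory L A T₀ i') j) =
      P.stageValue L T₀ i' (A.query (P.stageHistory L A T₀ i') j)) :
    A.history (P.value L) i = P.stageHistory L A T₀ i := by
  induction i with
  | zero => rfl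
  | succ i ih =>
    rw [AdaptiveAlgorithm.history, stageHistory, ih fun i' hi' => h i' (by omega)]
    simp only [h i (Nat.lt_succ_self i)]

end Run

end LayerParams

/-! ### Independent random labels -/

section RandomLabels

variable {E : Type} [Fintype E] {N : ℕ}

/-- The probability of the labelling `L` when the labels are chosen independently from the
distribution `p`. -/
noncomputable def labelWeight (p : ℕ → ℝ) (L : E → Fin N) : ℝ := ∏ e, p (L e)

open Classical in
/-- The probability of the event `φ` when the labels of the elements are chosen independently from
the distribution `p` on `{0, …, N - 1}`. -/
noncomputable def labelProb (E : Type) [Fintype E] [DecidableEq E] (N : ℕ) (p : ℕ → ℝ)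
    (φ : (E → ℕ) → Prop) : ℝ :=
  ∑ L : E → Fin N, labelWeight p L * if φ (fun e => L e) then 1 else 0

theorem labelWeight_nonneg {p : ℕ → ℝ} (hp : ∀ l, 0 ≤ p l) (L : E → Fin N) :
    0 ≤ labelWeight p L := Finset.prod_nonneg fun _ _ => hp _

variable [DecidableEq E]

theorem sum_labelWeight {p : ℕ → ℝ} (hp : ∑ l ∈ Finset.range N, p l = 1) :
    ∑ L : E → Fin N, labelWeight p L = 1 := by
  unfold labelWeight
  rw [← Fintype.prod_sum (fun (_ : E) (l : Fin N) => p l)]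
  simp [Fin.sum_univ_eq_sum_range, hp]

theorem labelProb_mono {p : ℕ → ℝ} (hp : ∀ l, 0 ≤ p l) {φ ψ : (E → ℕ) → Prop}
    (h : ∀ L : E → Fin N, φ (fun e => L e) → ψ (fun e => L e)) :
    labelProb E N p φ ≤ labelProb E N p ψ := by
  refine Finset.sum_le_sum fun L _ => mul_le_mul_of_nonneg_left ?_ (labelWeight_nonneg hp L)
  split_ifs with h1 h2 <;> first | exact absurd (h L h1) h2 | norm_num

theorem labelProb_or_le {p : ℕ → ℝ} (hp : ∀ l, 0 ≤ p l) (φ ψ : (E → ℕ) → Prop) :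
    labelProb E N p (fun L => φ L ∨ ψ L) ≤ labelProb E N p φ + labelProb E N p ψ := by
  unfold labelProb
  rw [← Finset.sum_add_distrib]
  refine Finset.sum_le_sum fun L _ => ?_
  rw [← mul_add]
  refine mul_le_mul_of_nonneg_left ?_ (labelWeight_nonneg hp L)
  split_ifs <;> first | tauto | norm_num

theorem labelProb_exists_le {p : ℕ → ℝ} (hp : ∀ l, 0 ≤ p l) {ι : Type} (s : Finset ι)
    (φ : ι → (E → ℕ) → Prop) :
    labelProb E N p (fun L => ∃ j ∈ s, φ j L) ≤ ∑ j ∈ s, labelProb E N p (φ j) := by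
  classical
  induction s using Finset.induction_on with
  | empty => simp [labelProb]
  | insert x s hx ih =>
    rw [Finset.sum_insert hx]
    refine le_trans ?_ ((labelProb_or_le hp (φ x) fun L => ∃ j ∈ s, φ j L).trans
      (add_le_add_right ih _))
    exact labelProb_mono hp fun L hL => by simpa using hL

/-- An exponential moment bound. The set `Q` may depend on which elements have a label less than
`i`, and on these labels; given this information the other labels are still independent. -/
theorem sum_labelWeight_exp_le {p : ℕ → ℝ} (hp : ∀ l, 0 ≤ p l)
    (hp1 : ∑ l ∈ Finset.range N, p l = 1) (i : ℕ) (z : ℕ → ℝ)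
    (hz : ∑ l ∈ Finset.Ico i N, p l * Real.exp (z l) ≤ ∑ l ∈ Finset.Ico i N, p l)
    (Q : (E → ℕ) → Finset E) :
    ∑ L : E → Fin N, labelWeight p L *
      Real.exp (∑ e ∈ LayerParams.late (fun e => (L e : ℕ)) i (Q fun e => min (L e : ℕ) i),
        z (L e)) ≤ 1 := by
  have hIco : ∀ f : ℕ → ℝ, ∑ l ∈ Finset.univ.filter (fun l : Fin N => i ≤ (l : ℕ)), f l =
      ∑ l ∈ Finset.Ico i N, f l := by
    intro f
    rw [Finset.sum_filter, Fin.sum_univ_eq_sum_range (fun l => if i ≤ l then f l else 0),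
      ← Finset.sum_filter]
    congr 1
    ext l
    simp [and_comm]
  -- the labellings are grouped by the known part `min (L e) i` of the labels; on each group the
  -- sum is a product over the elements
  let tr : (E → Fin N) → E → ℕ := fun L e => min (L e : ℕ) i
  rw [← sum_labelWeight (E := E) hp1,
    ← Finset.sum_fiberwise_of_maps_to (s := Finset.univ) (t := Finset.univ.image tr) (g := tr)
      (fun L _ => Finset.mem_image_of_mem _ (Finset.mem_univ L)),
    ← Finset.sum_fiberwise_of_maps_to (s := Finset.univ) (t := Finset.univ.image tr) (g := tr)
      (fun L _ => Finset.mem_image_of_mem _ (Finset.mem_univ L)) (labelWeight p)]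
  refine Finset.sum_le_sum fun g _ => ?_
  have hfib : Finset.univ.filter (fun L : E → Fin N => tr L = g) =
      Fintype.piFinset fun e => Finset.univ.filter fun l : Fin N => min (l : ℕ) i = g e := by
    ext L
    simp [tr, funext_iff]
  have hprod : ∀ L ∈ Finset.univ.filter (fun L : E → Fin N => tr L = g),
      labelWeight p L * Real.exp (∑ e ∈ LayerParams.late (fun e => (L e : ℕ)) i
        (Q fun e => min (L e : ℕ) i), z (L e)) =
      ∏ e, p (L e) * if e ∈ Q g ∧ i ≤ (L e : ℕ) then Real.exp (z (L e)) else 1 := by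
    intro L hL
    have hL' : (fun e => min (L e : ℕ) i) = g := (Finset.mem_filter.1 hL).2
    rw [hL', Finset.prod_mul_distrib, labelWeight, Real.exp_sum, ← Finset.prod_filter]
    congr 1
    refine Finset.prod_congr ?_ fun _ _ => rfl
    ext e
    simp [LayerParams.late]
  rw [Finset.sum_congr rfl hprod, hfib]
  unfold labelWeight
  rw [← Finset.prod_univ_sum (fun e => Finset.univ.filter fun l : Fin N => min (l : ℕ) i = g e)
      (fun e l => p l * if e ∈ Q g ∧ i ≤ (l : ℕ) then Real.exp (z l) else 1),
    ← Finset.prod_univ_sum (fun e => Finset.univ.filter fun l : Fin N => min (l : ℕ) i = g e)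
      (fun _ l => p l)]
  refine Finset.prod_le_prod (fun e _ => Finset.sum_nonneg fun l _ => mul_nonneg (hp _) ?_)
    fun e _ => ?_
  · split_ifs <;> positivity
  · by_cases he : e ∈ Q g ∧ g e = i
    · have hset : (Finset.univ.filter fun l : Fin N => min (l : ℕ) i = g e) =
          Finset.univ.filter fun l : Fin N => i ≤ (l : ℕ) :=
        Finset.filter_congr fun l _ => by omega
      rw [hset, hIco p, Finset.sum_congr rfl (g := fun l : Fin N => p l * Real.exp (z l)),
        hIco fun l => p l * Real.exp (z l)]
      · exact hz
      · intro l hl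
        rw [if_pos ⟨he.1, (Finset.mem_filter.1 hl).2⟩]
    · refine le_of_eq (Finset.sum_congr rfl fun l hl => ?_)
      rw [if_neg, mul_one]
      rintro ⟨h1, h2⟩
      have := (Finset.mem_filter.1 hl).2
      exact he ⟨h1, by omega⟩

/-- Markov's inequality for the exponential moment of `sum_labelWeight_exp_le`. -/
theorem labelProb_lt_sum_le {p : ℕ → ℝ} (hp : ∀ l, 0 ≤ p l)
    (hp1 : ∑ l ∈ Finset.range N, p l = 1) (i : ℕ) (z : ℕ → ℝ)
    (hz : ∑ l ∈ Finset.Ico i N, p l * Real.exp (z l) ≤ ∑ l ∈ Finset.Ico i N, p l)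
    (Q : (E → ℕ) → Finset E) (A : ℝ) :
    labelProb E N p (fun L => A < ∑ e ∈ LayerParams.late L i (Q fun e => min (L e) i), z (L e)) ≤
      Real.exp (-A) := by
  have h := mul_le_mul_of_nonneg_left (sum_labelWeight_exp_le (E := E) hp hp1 i z hz Q)
    (Real.exp_pos (-A)).le
  rw [mul_one, Finset.mul_sum] at h
  refine le_trans (Finset.sum_le_sum fun L _ => ?_) h
  rw [mul_left_comm]
  refine mul_le_mul_of_nonneg_left ?_ (labelWeight_nonneg hp L)
  rw [← Real.exp_add]
  split_ifs with h1
  · rw [Real.one_le_exp_iff]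
    linarith
  · positivity

end RandomLabels

/-- The exponential moment behind the decrease of the layer counts: for labels `j + 1` and `j` with
probabilities of ratio at most `1 - g`, the variable `g / 4` on the label `j + 1` and
`-(g / 4) (1 - g / 2)` on the label `j` has exponential moment at most `1`. -/
theorem one_sub_mul_exp_sub_one_le {g : ℝ} (h0 : 0 ≤ g) (h1 : g ≤ 1 / 2) :
    (1 - g) * (Real.exp (g / 4) - 1) ≤ 1 - Real.exp (-(g / 4 * (1 - g / 2))) := by
  have e1 := abs_le.1 (Real.abs_exp_sub_one_sub_id_le (x := g / 4)
    (by rw [abs_le]; constructor <;> linarith))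
  have hs0 : 0 ≤ g / 4 * (1 - g / 2) := mul_nonneg (by linarith) (by linarith)
  have hs1 : g / 4 * (1 - g / 2) ≤ g / 4 := by nlinarith
  have e2 := abs_le.1 (Real.abs_exp_sub_one_sub_id_le (x := -(g / 4 * (1 - g / 2)))
    (by rw [abs_le]; constructor <;> linarith))
  have e3 : (1 - g) * (Real.exp (g / 4) - 1) ≤ (1 - g) * (g / 4 + (g / 4) ^ 2) :=
    mul_le_mul_of_nonneg_left (by linarith [e1.2]) (by linarith)
  have e4 : (g / 4 * (1 - g / 2)) ^ 2 ≤ (g / 4) ^ 2 := pow_le_pow_left₀ hs0 hs1 2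
  have e5 := e2.2
  nlinarith

namespace LayerParams

variable {E : Type} {P : LayerParams} {p : ℕ → ℝ} {g q Λ T₀ : ℝ}

/-- The conditions on the numerical parameters under which random labels with the distribution `p`
give a hard instance: `g` is the relative decrease of the layers, `q` bounds the density of the
hidden set, `exp (-Λ)` the probability of a deviation, and sets with more than `T₀` unknown
elements already have the maximal value. -/
structure Admissible (P : LayerParams) (n : ℕ) (p : ℕ → ℝ) (g q Λ T₀ : ℝ) : Prop where
  g_pos : 0 < g
  g_le : g ≤ 1 / 2
  a_eq : P.a = 1 - g / 2
  slack_eq : P.slack = 4 * Λ / g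
  p_pos : ∀ l, 0 < p l
  sum_p : ∑ l ∈ Finset.range (P.r + 2), p l = 1
  decay : ∀ j < P.r, p (j + 1) ≤ (1 - g) * p j
  hidden_le : p (P.r + 1) ≤ q * p P.r
  q_nonneg : 0 ≤ q
  q_le : q ≤ 1 / 8
  Λ_le : 4 * Λ ≤ T₀
  j₀_ge : 2 * q * T₀ + Λ ≤ P.j₀
  τ_ge : 24 * P.K ≤ P.τ * T₀
  card_le : (P.K + P.j₀ : ℝ) ≤ T₀
  slack_le : 2 * (P.r + 1) * P.slack ≤ (1 - P.a) * P.K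
  hidden_ge : (P.K + P.j₀ : ℝ) + Λ ≤ n * p (P.r + 1) / 2

/-! ### Random labels make queries balanced -/

section

theorem sum_late_indicator (L : E → ℕ) {i j : ℕ} (hij : i ≤ j) (S : Finset E) (c : ℝ) :
    ∑ e ∈ late L i S, (if L e = j then c else 0) = c * count L j S := by
  rw [← Finset.sum_filter, Finset.sum_const, nsmul_eq_mul, mul_comm, late, Finset.filter_filter,
    count]
  congr 3
  exact Finset.filter_congr fun e _ => by omega

variable [Fintype E] [DecidableEq E] {n : ℕ}

/-- A query that depends on the layers before `i` is unlikely to have too many elements in a later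
layer, compared with the layer before it. -/
theorem Admissible.labelProb_increasing_le (hP : P.Admissible n p g q Λ T₀) {i j : ℕ}
    (hij : i ≤ j) (hj : j < P.r) (Q : (E → ℕ) → Finset E) :
    labelProb E (P.r + 2) p (fun L => P.a * count L j (Q fun e => min (L e) i) + P.slack <
      count L (j + 1) (Q fun e => min (L e) i)) ≤ Real.exp (-Λ) := by
  have hg := hP.g_pos
  let z : ℕ → ℝ := fun l => (if l = j + 1 then g / 4 else 0) +
    (if l = j then -(g / 4 * P.a) else 0)
  have hz : ∑ l ∈ Finset.Ico i (P.r + 2), p l * Real.exp (z l) ≤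
      ∑ l ∈ Finset.Ico i (P.r + 2), p l := by
    have h1 : ∀ l ∈ Finset.Ico i (P.r + 2), p l * Real.exp (z l) =
        p l + (if l = j + 1 then p l * (Real.exp (g / 4) - 1) else 0)
          + (if l = j then p l * (Real.exp (-(g / 4 * P.a)) - 1) else 0) := by
      intro l _
      simp only [z]
      split_ifs with h2 h3 h3
      · omega
      · rw [add_zero]; ring
      · rw [zero_add]; ring
      · simp
    rw [Finset.sum_congr rfl h1, Finset.sum_add_distrib, Finset.sum_add_distrib,
      Finset.sum_ite_eq', Finset.sum_ite_eq', if_pos (by simp; omega), if_pos (by simp; omega)]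
    have h2 := one_sub_mul_exp_sub_one_le hg.le hP.g_le
    rw [← hP.a_eq] at h2
    have h3 : 0 ≤ Real.exp (g / 4) - 1 := by linarith [Real.add_one_le_exp (g / 4)]
    have h4 := mul_le_mul_of_nonneg_right (hP.decay j hj) h3
    have h5 := mul_le_mul_of_nonneg_left h2 (hP.p_pos j).le
    linarith
  refine (labelProb_mono (fun l => (hP.p_pos l).le) fun L hL => ?_).trans
    (labelProb_lt_sum_le (fun l => (hP.p_pos l).le) hP.sum_p i z hz Q Λ)
  simp only [z, Finset.sum_add_distrib]
  rw [sum_late_indicator _ (by omega), sum_late_indicator _ hij]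
  have h1 : Λ = g / 4 * P.slack := by rw [hP.slack_eq]; field_simp
  have h2 := mul_lt_mul_of_pos_left hL (show 0 < g / 4 by linarith)
  linarith

/-- A query that depends on the layers before `i` is unlikely to have many hidden elements. -/
theorem Admissible.labelProb_hidden_le (hP : P.Admissible n p g q Λ T₀) {i : ℕ}
    (hi : i ≤ P.r) (Q : (E → ℕ) → Finset E) :
    labelProb E (P.r + 2) p (fun L => 2 * q * (late L i (Q fun e => min (L e) i)).card + Λ <
      count L (P.r + 1) (Q fun e => min (L e) i)) ≤ Real.exp (-Λ) := by
  let z : ℕ → ℝ := fun l => (if l = P.r + 1 then 1 else 0) - 2 * q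
  have hz : ∑ l ∈ Finset.Ico i (P.r + 2), p l * Real.exp (z l) ≤
      ∑ l ∈ Finset.Ico i (P.r + 2), p l := by
    have h1 : ∀ l ∈ Finset.Ico i (P.r + 2), p l * Real.exp (z l) = Real.exp (-(2 * q)) *
        (p l + (if l = P.r + 1 then p l * (Real.exp 1 - 1) else 0)) := by
      intro l _
      simp only [z, sub_eq_add_neg, Real.exp_add]
      split_ifs
      · ring
      · rw [Real.exp_zero]; ring
    rw [Finset.sum_congr rfl h1, ← Finset.mul_sum, Finset.sum_add_distrib,
      Finset.sum_ite_eq', if_pos (by simp; omega), Real.exp_neg,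
      inv_mul_le_iff₀ (Real.exp_pos _)]
    have h2 : p P.r ≤ ∑ l ∈ Finset.Ico i (P.r + 2), p l :=
      Finset.single_le_sum (fun l _ => (hP.p_pos l).le) (by simp; omega)
    have h3 := hP.hidden_le
    have h4 := Real.exp_one_lt_d9
    have h5 := Real.add_one_le_exp (2 * q)
    have h6 := mul_le_mul_of_nonneg_left h2 hP.q_nonneg
    have h7 := hP.p_pos (P.r + 1)
    have h8 : p (P.r + 1) * (Real.exp 1 - 1) ≤ p (P.r + 1) * 2 :=
      mul_le_mul_of_nonneg_left (by linarith) h7.le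
    have h9 := hP.p_pos P.r
    have h10 := mul_le_mul_of_nonneg_right h5 (h9.le.trans h2)
    linarith
  refine (labelProb_mono (fun l => (hP.p_pos l).le) fun L hL => ?_).trans
    (labelProb_lt_sum_le (fun l => (hP.p_pos l).le) hP.sum_p i z hz Q Λ)
  simp only [z, Finset.sum_sub_distrib]
  rw [sum_late_indicator _ (by omega), Finset.sum_const, nsmul_eq_mul]
  linarith

theorem Admissible.labelProb_not_balanced_le (hP : P.Admissible n p g q Λ T₀) {i : ℕ}
    (hi : i ≤ P.r) (Q : (E → ℕ) → Finset E) :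
    labelProb E (P.r + 2) p (fun L => ¬ P.Balanced L q Λ i (Q fun e => min (L e) i)) ≤
      (P.r + 1) * Real.exp (-Λ) := by
  have hp : ∀ l, 0 ≤ p l := fun l => (hP.p_pos l).le
  have h1 := labelProb_exists_le (E := E) (N := P.r + 2) hp (Finset.Ico i P.r)
    fun j L => P.a * count L j (Q fun e => min (L e) i) + P.slack <
      count L (j + 1) (Q fun e => min (L e) i)
  have h2 := Finset.sum_le_card_nsmul (Finset.Ico i P.r)
    (fun j => labelProb E (P.r + 2) p (fun L => P.a * count L j (Q fun e => min (L e) i) +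
      P.slack < count L (j + 1) (Q fun e => min (L e) i))) (Real.exp (-Λ))
    fun j hj => by
      rw [Finset.mem_Ico] at hj
      exact hP.labelProb_increasing_le hj.1 hj.2 Q
  have h3 := hP.labelProb_hidden_le hi Q
  have h4 : (Finset.Ico i P.r).card • Real.exp (-Λ) ≤ P.r * Real.exp (-Λ) := by
    rw [nsmul_eq_mul, Nat.card_Ico]
    refine mul_le_mul_of_nonneg_right ?_ (Real.exp_pos _).le
    exact_mod_cast Nat.sub_le _ _
  refine le_trans (le_trans (labelProb_mono hp fun L hL => ?_) (labelProb_or_le hp _ _))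
    ((add_le_add ((h1.trans h2).trans h4) h3).trans (by linarith))
  by_contra hcon
  push Not at hcon
  refine hL ⟨fun j hij hj => ?_, ?_⟩
  · exact hcon.1 j (Finset.mem_Ico.2 ⟨hij, hj⟩)
  · exact hcon.2

/-- The hidden set has at least `K + j₀` elements with high probability. -/
theorem Admissible.labelProb_few_hidden_le (hP : P.Admissible (Fintype.card E) p g q Λ T₀) :
    labelProb E (P.r + 2) p (fun L => ¬ P.K + P.j₀ ≤ count L (P.r + 1) Finset.univ) ≤
      Real.exp (-Λ) := by
  set π := p (P.r + 1) with hπ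
  let z : ℕ → ℝ := fun l => π / 2 - (if l = P.r + 1 then 1 else 0)
  have hz : ∑ l ∈ Finset.Ico 0 (P.r + 2), p l * Real.exp (z l) ≤
      ∑ l ∈ Finset.Ico 0 (P.r + 2), p l := by
    have h1 : ∀ l ∈ Finset.Ico 0 (P.r + 2), p l * Real.exp (z l) = Real.exp (π / 2) *
        (p l + (if l = P.r + 1 then p l * (Real.exp (-1) - 1) else 0)) := by
      intro l _
      simp only [z, sub_eq_add_neg, Real.exp_add]
      split_ifs
      · ring
      · rw [neg_zero, Real.exp_zero]; ring
    rw [Finset.sum_congr rfl h1, ← Finset.mul_sum, Finset.sum_add_distrib,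
      Finset.sum_ite_eq', if_pos (by simp), ← Finset.range_eq_Ico, hP.sum_p, ← hπ]
    have h2 : Real.exp (-1) ≤ 1 / 2 := by
      rw [Real.exp_neg, inv_le_comm₀ (Real.exp_pos _) (by norm_num)]
      linarith [Real.add_one_le_exp (1 : ℝ)]
    have h3 := Real.add_one_le_exp (-(π / 2))
    have h4 := hP.p_pos (P.r + 1)
    rw [← hπ] at h4
    have h5 : 1 + π * (Real.exp (-1) - 1) ≤ Real.exp (-(π / 2)) := by nlinarith
    calc _ ≤ Real.exp (π / 2) * Real.exp (-(π / 2)) :=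
          mul_le_mul_of_nonneg_left h5 (Real.exp_pos _).le
      _ = 1 := by rw [← Real.exp_add]; simp
  refine (labelProb_mono (fun l => (hP.p_pos l).le) fun L hL => ?_).trans
    (labelProb_lt_sum_le (fun l => (hP.p_pos l).le) hP.sum_p 0 z hz (fun _ => Finset.univ) Λ)
  simp only [z, Finset.sum_sub_distrib]
  rw [sum_late_indicator _ (by omega), Finset.sum_const, nsmul_eq_mul]
  have h1 : (late (fun e => (L e : ℕ)) 0 (Finset.univ : Finset E)).card = Fintype.card E := by
    simp [late]
  have h2 : (count (fun e => (L e : ℕ)) (P.r + 1) Finset.univ : ℝ) < P.K + P.j₀ := by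
    exact_mod_cast not_le.1 hL
  have h3 := hP.hidden_ge
  rw [h1]
  linarith

variable (P) in
/-- The bound on the value that an algorithm achieves with high probability. -/
noncomputable def bound : ℝ :=
  1 - (1 - P.h) ^ (P.K + P.j₀) * (1 + (1 - P.a) ^ 2 / (64 * (P.r + 1)))

/-- A deterministic algorithm is unlikely to beat `bound` on a random instance. -/
theorem Admissible.labelProb_bound_lt_le (hP : P.Admissible (Fintype.card E) p g q Λ T₀) {m : ℕ}
    (A : AdaptiveAlgorithm E (P.K + P.j₀) m) (hcard : P.K + P.j₀ ≤ Fintype.card E) :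
    labelProb E (P.r + 2) p (fun L => P.bound < P.value L (A.run (P.value L) P.r)) ≤
      (P.r * m + 1) * ((P.r + 1) * Real.exp (-Λ)) := by
  have hp : ∀ l, 0 ≤ p l := fun l => (hP.p_pos l).le
  -- the returned set is extended to one of size exactly `K + j₀`
  have hext : ∀ h, ∃ S : Finset E, A.output h ⊆ S ∧ S.card = P.K + P.j₀ := fun h =>
    Finset.exists_superset_card_eq (A.card_output_le h) hcard
  choose ext hsub hext using hext
  let Q : ℕ → Fin m → (E → ℕ) → Finset E := fun i j L => A.query (P.stageHistory L A T₀ i) j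
  let R : (E → ℕ) → Finset E := fun L => ext (P.stageHistory L A T₀ P.r)
  have hQ : ∀ i j L, Q i j (fun e => min (L e) i) = Q i j L := fun i j L => by
    simp only [Q]
    rw [stageHistory_congr (L' := L) A T₀ (fun e => by simp)]
  have hR : ∀ L, R (fun e => min (L e) P.r) = R L := fun L => by
    simp only [R]
    rw [stageHistory_congr (L' := L) A T₀ (fun e => by simp)]
  have h1 := labelProb_exists_le (E := E) (N := P.r + 2) hp
    (Finset.range P.r ×ˢ (Finset.univ : Finset (Fin m)))
    fun ij L => ¬ P.Balanced L q Λ ij.1 (Q ij.1 ij.2 fun e => min (L e) ij.1)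
  have h2 := Finset.sum_le_card_nsmul (Finset.range P.r ×ˢ (Finset.univ : Finset (Fin m)))
    (fun ij => labelProb E (P.r + 2) p
      (fun L => ¬ P.Balanced L q Λ ij.1 (Q ij.1 ij.2 fun e => min (L e) ij.1)))
    ((P.r + 1) * Real.exp (-Λ)) fun ij hij => by
      have := Finset.mem_range.1 (Finset.mem_product.1 hij).1
      exact hP.labelProb_not_balanced_le this.le (Q ij.1 ij.2)
  rw [Finset.card_product, Finset.card_range, Finset.card_fin, nsmul_eq_mul] at h2
  push_cast at h2
  have h3 := hP.labelProb_not_balanced_le le_rfl R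
  refine le_trans (le_trans (labelProb_mono hp fun L hL => ?_) (labelProb_or_le hp _ _))
    ((add_le_add (h1.trans h2) h3).trans (by linarith))
  by_contra hcon
  push Not at hcon
  obtain ⟨hbal, hbalR⟩ := hcon
  refine absurd hL (not_lt.2 ?_)
  have hhist : A.history (P.value fun e => (L e : ℕ)) P.r =
      P.stageHistory (fun e => (L e : ℕ)) A T₀ P.r := by
    refine history_eq_stageHistory A T₀ fun i hi j => ?_
    have h4 := hbal (i, j) (by simp [hi])
    simp only [hQ] at h4
    exact h4.value_eq hi.le hP.q_nonneg hP.q_le hP.Λ_le hP.j₀_ge hP.τ_ge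
  rw [hR] at hbalR
  rw [AdaptiveAlgorithm.run, hhist]
  refine ((P.value_isMonotoneSubmodular _).monotone (hsub _)).trans ?_
  refine hbalR.value_le (fun e => by have := (L e).2; omega) (hext _) hP.q_nonneg ?_ hP.slack_le
  have h5 := mul_le_mul_of_nonneg_left hP.card_le (show 0 ≤ 2 * q by linarith [hP.q_nonneg])
  linarith [hP.j₀_ge]

end

end LayerParams

/-! ### Randomized algorithms -/

namespace RandomizedAlgorithm

variable {E Ω : Type} {k r m : ℕ} [MeasurableSpace Ω]

theorem measurableSet_run (A : RandomizedAlgorithm E k r m Ω) [Fintype E] (f : Finset E → ℝ)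
    (s : Set (Finset E)) : MeasurableSet {ω | (A.alg ω).run f r ∈ s} := by
  have h : {ω | (A.alg ω).run f r ∈ s} = ⋃ S ∈ s, {ω | (A.alg ω).run f r = S} := by
    ext ω
    simp
  rw [h]
  exact MeasurableSet.biUnion s.to_countable fun S _ => A.measurableSet_output f S

end RandomizedAlgorithm

theorem NoBetterApproximation.mono {n r m : ℕ} {β η η' : ℝ}
    (h : NoBetterApproximation n r m β η) (hη : η ≤ η') : NoBetterApproximation n r m β η' := by
  obtain ⟨k, hk⟩ := h
  refine ⟨k, fun Ω _ A => ?_⟩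
  obtain ⟨f, h1, h2, h3, h4⟩ := hk Ω A
  exact ⟨f, h1, h2, h3, h4.trans hη⟩

theorem LayerParams.bound_nonneg (P : LayerParams) : 0 ≤ P.bound := by
  have h0 := P.h_pos
  have h1 := P.h_le_one
  have hK : (0 : ℝ) < P.K := by exact_mod_cast P.K_pos
  have h2 : (1 - P.h) ^ (P.K + P.j₀) ≤ 1 / 2 := by
    calc (1 - P.h) ^ (P.K + P.j₀) ≤ (1 - P.h) ^ P.K :=
          pow_le_pow_of_le_one (by linarith) (by linarith) (Nat.le_add_right _ _)
      _ ≤ Real.exp (-P.h) ^ P.K :=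
          pow_le_pow_left₀ (by linarith) (by linarith [Real.add_one_le_exp (-P.h)]) _
      _ = Real.exp (-1) := by
          rw [← Real.exp_nat_mul]
          congr 1
          rw [h]; field_simp
      _ ≤ 1 / 2 := by
          rw [Real.exp_neg, inv_le_comm₀ (Real.exp_pos _) (by norm_num)]
          linarith [Real.add_one_le_exp (1 : ℝ)]
  have h3 : (1 - P.a) ^ 2 / (64 * (P.r + 1)) ≤ 1 := by
    have h4 : (1 - P.a) ^ 2 ≤ 1 := pow_le_one₀ (by linarith [P.a_le_one]) (by linarith [P.a_nonneg])
    have h5 : (0 : ℝ) ≤ P.r := Nat.cast_nonneg _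
    rw [div_le_one (by positivity)]
    linarith
  have h6 : 0 ≤ (1 - P.h) ^ (P.K + P.j₀) := pow_nonneg (by linarith) _
  unfold bound
  nlinarith

/-- The minimax argument: if random labels make every deterministic algorithm fail with
high probability, then for every randomized algorithm some fixed labels make it fail with high
probability. -/
theorem LayerParams.Admissible.noBetterApproximation {P : LayerParams} {n m : ℕ} {p : ℕ → ℝ}
    {g q Λ T₀ β η : ℝ} (hP : P.Admissible n p g q Λ T₀) (hcard : P.K + P.j₀ ≤ n)
    (hτ : P.τ < 1)
    (hη : ((P.r * m + 1) * (P.r + 1) + 1) * Real.exp (-Λ) ≤ η) (hη1 : η < 1)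
    (hβ : P.bound + η ≤ β * (1 - P.τ)) :
    NoBetterApproximation n P.r m β η := by
  refine ⟨P.K + P.j₀, fun Ω _ A => ?_⟩
  have := A.isProbabilityMeasure
  have hp : ∀ l, 0 ≤ p l := fun l => (hP.p_pos l).le
  have hη0 : 0 ≤ η := by
    refine le_trans ?_ hη
    positivity
  let f : (Fin n → Fin (P.r + 2)) → Finset (Fin n) → ℝ := fun L => P.value fun e => (L e : ℕ)
  let B : (Fin n → Fin (P.r + 2)) → Set Ω := fun L =>
    {ω | P.bound < f L ((A.alg ω).run (f L) P.r)}
  have hB : ∀ L, MeasurableSet (B L) := fun L =>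
    A.measurableSet_run (f L) {S | P.bound < f L S}
  have hE : P.Admissible (Fintype.card (Fin n)) p g q Λ T₀ := by rwa [Fintype.card_fin]
  -- averaging over the seed and the labels
  have havg : ∑ L : Fin n → Fin (P.r + 2), labelWeight p L * A.law.real (B L) ≤
      (P.r * m + 1) * ((P.r + 1) * Real.exp (-Λ)) := by
    have h1 : ∀ L, labelWeight p L * A.law.real (B L) =
        ∫ ω, labelWeight p L * (B L).indicator 1 ω ∂A.law := fun L => by
      rw [integral_const_mul, integral_indicator_one (hB L)]
    have hint : ∀ L ∈ Finset.univ, Integrable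
        (fun ω => labelWeight p L * (B L).indicator (1 : Ω → ℝ) ω) A.law := fun L _ =>
      ((integrable_const (1 : ℝ)).indicator (hB L)).const_mul _
    rw [Finset.sum_congr rfl fun L _ => h1 L, ← integral_finsetSum _ hint]
    refine (integral_mono (integrable_finsetSum _ hint) (integrable_const
      ((P.r * m + 1) * ((P.r + 1) * Real.exp (-Λ)))) fun ω => ?_).trans (by simp)
    refine le_trans (le_of_eq ?_) (hE.labelProb_bound_lt_le (A.alg ω) (by simpa using hcard))
    refine Finset.sum_congr rfl fun L _ => ?_
    simp only [Set.indicator_apply, B, f, Set.mem_ofPred_eq, Pi.one_apply]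
  have hfew := hE.labelProb_few_hidden_le
  obtain ⟨L, hL⟩ : ∃ L : Fin n → Fin (P.r + 2), A.law.real (B L) ≤ η ∧
      P.K + P.j₀ ≤ count (fun e => (L e : ℕ)) (P.r + 1) Finset.univ := by
    classical
    by_contra hcon
    push Not at hcon
    have hsum := sum_labelWeight (E := Fin n) hP.sum_p
    have hlt : ∀ L : Fin n → Fin (P.r + 2), labelWeight p L * η < labelWeight p L *
        A.law.real (B L) + labelWeight p L *
          if ¬ P.K + P.j₀ ≤ count (fun e => (L e : ℕ)) (P.r + 1) Finset.univ then 1 else 0 := by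
      intro L
      rw [← mul_add]
      refine mul_lt_mul_of_pos_left ?_ (Finset.prod_pos fun _ _ => hP.p_pos _)
      have h0 : 0 ≤ A.law.real (B L) := measureReal_nonneg
      split_ifs with h
      · rw [add_zero]
        by_contra h'
        exact absurd h (not_le.2 (hcon L (not_lt.1 h')))
      · linarith
    obtain ⟨L₀⟩ : Nonempty (Fin n → Fin (P.r + 2)) := ⟨fun _ => 0⟩
    have h1 := Finset.sum_lt_sum_of_nonempty (s := Finset.univ) ⟨L₀, Finset.mem_univ _⟩
      fun L _ => hlt L
    rw [← Finset.sum_mul, hsum, one_mul, Finset.sum_add_distrib] at h1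
    have h2 : ∑ L : Fin n → Fin (P.r + 2), (labelWeight p L *
        if ¬ P.K + P.j₀ ≤ count (fun e => (L e : ℕ)) (P.r + 1) Finset.univ then 1 else 0) ≤
        Real.exp (-Λ) := by
      refine le_trans (le_of_eq ?_) hfew
      exact Finset.sum_congr rfl fun L _ => by congr
    linarith
  have hopt := P.optValue_value (fun e => (L e : ℕ)) hL.2
  refine ⟨f L, P.value_isMonotoneSubmodular _, ?_, ?_, ?_⟩
  · rw [hopt]; linarith
  · rw [hopt]
    have hmono : ∫ ω, f L ((A.alg ω).run (f L) P.r) ∂A.law ≤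
        ∫ ω, (P.bound + (B L).indicator 1 ω) ∂A.law := by
      refine integral_mono_of_nonneg (Filter.Eventually.of_forall fun ω => ?_)
        ((integrable_const _).add ((integrable_const (1 : ℝ)).indicator (hB L)))
        (Filter.Eventually.of_forall fun ω => ?_)
      · have h := (P.value_isMonotoneSubmodular fun e => (L e : ℕ))
        exact h.map_empty.ge.trans (h.monotone (Finset.empty_subset _))
      · by_cases h : ω ∈ B L
        · have h1 := P.value_le_one (fun e => (L e : ℕ)) ((A.alg ω).run (f L) P.r)
          simp only [Set.indicator_of_mem h, Pi.one_apply]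
          have h2 : 0 ≤ P.bound := P.bound_nonneg
          change P.value _ _ ≤ _
          linarith
        · simp only [Set.indicator_of_notMem h, add_zero]
          exact not_lt.1 h
    refine hmono.trans ?_
    have hadd := integral_add (μ := A.law) (integrable_const P.bound)
      ((integrable_const (1 : ℝ)).indicator (hB L))
    have hind : ∫ ω, (B L).indicator (fun _ => (1 : ℝ)) ω ∂A.law = A.law.real (B L) :=
      integral_indicator_one (hB L)
    rw [hind, integral_const, probReal_univ, one_smul] at hadd
    refine hadd.le.trans ?_
    linarith [hL.1]
  · refine le_trans (measureReal_mono fun ω hω => ?_) hL.1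
    rw [Set.mem_ofPred_eq, hopt] at hω
    change P.bound < _
    linarith

/-! ### The choice of the parameters -/

/-- The weights of the labels, up to normalization: the layers `0, …, r` decrease geometrically by
the factor `1 - g`, and the hidden set, with the label `r + 1`, has the fraction `q` of the weight
of the last layer. -/
noncomputable def rawWeight (r : ℕ) (g q : ℝ) (l : ℕ) : ℝ :=
  if l = r + 1 then q * (1 - g) ^ r else (1 - g) ^ l

theorem rawWeight_pos {r : ℕ} {g q : ℝ} (hg : g ≤ 1 / 2) (hq : 0 < q) (l : ℕ) :
    0 < rawWeight r g q l := by
  have h : 0 < 1 - g := by linarith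
  unfold rawWeight
  split_ifs <;> positivity

theorem sum_rawWeight_le {r : ℕ} {g q : ℝ} (hg0 : 0 ≤ g) (hg : g ≤ 1 / 2) (hq0 : 0 ≤ q)
    (hq : q ≤ 1) : ∑ l ∈ Finset.range (r + 2), rawWeight r g q l ≤ r + 2 := by
  have h : ∀ l ∈ Finset.range (r + 2), rawWeight r g q l ≤ 1 := by
    intro l _
    have h1 : ∀ l, (1 - g) ^ l ≤ 1 := fun l => pow_le_one₀ (by linarith) (by linarith)
    have h2 : 0 ≤ (1 - g) ^ r := pow_nonneg (by linarith) _
    unfold rawWeight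
    split_ifs
    · nlinarith [h1 r]
    · exact h1 l
  refine (Finset.sum_le_card_nsmul _ _ _ h).trans ?_
  simp

theorem exp_neg_le_one_sub_pow {g : ℝ} (hg0 : 0 ≤ g) (hg : g ≤ 1 / 2) (r : ℕ) :
    Real.exp (-(2 * g * r)) ≤ (1 - g) ^ r := by
  have h : Real.exp (-(2 * g)) ≤ 1 - g := by
    rw [Real.exp_neg, inv_le_comm₀ (Real.exp_pos _) (by linarith)]
    refine le_trans ?_ (Real.add_one_le_exp (2 * g))
    rw [inv_le_iff_one_le_mul₀ (by linarith)]
    nlinarith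
  calc Real.exp (-(2 * g * r)) = Real.exp (-(2 * g)) ^ r := by
        rw [← Real.exp_nat_mul]; congr 1; ring
    _ ≤ (1 - g) ^ r := pow_le_pow_left₀ (Real.exp_pos _).le h r

/-- The bound `(1 - 1/K)^(K + j) ≥ (1 - (j + 1)/K) / e`. -/
theorem one_sub_inv_pow_ge {K : ℕ} (hK : 2 ≤ K) (j : ℕ) :
    Real.exp (-1) * (1 - (j + 1) * (1 / K)) ≤ (1 - 1 / (K : ℝ)) ^ (K + j) := by
  obtain ⟨m, rfl⟩ : ∃ m, K = m + 1 := ⟨K - 1, by omega⟩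
  have hm : (0 : ℝ) < m := by exact_mod_cast (by omega : 0 < m)
  have hbase : 1 - 1 / ((m + 1 : ℕ) : ℝ) = m / (m + 1) := by
    push_cast; field_simp; ring
  have h1 : Real.exp (-1) ≤ (1 - 1 / ((m + 1 : ℕ) : ℝ)) ^ m := by
    have h2 : Real.exp (-(1 / m)) ≤ 1 - 1 / ((m + 1 : ℕ) : ℝ) := by
      rw [hbase, Real.exp_neg, inv_le_comm₀ (Real.exp_pos _) (by positivity)]
      refine le_trans (le_of_eq ?_) (Real.add_one_le_exp (1 / (m : ℝ)))
      field_simp; ring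
    calc Real.exp (-1) = Real.exp (-(1 / m)) ^ m := by
          rw [← Real.exp_nat_mul]; congr 1; field_simp
      _ ≤ _ := pow_le_pow_left₀ (Real.exp_pos _).le h2 m
  have h3 : (-1 : ℝ) ≤ -(1 / ((m + 1 : ℕ) : ℝ)) := by
    rw [neg_le_neg_iff, div_le_one (by positivity)]
    push_cast; linarith
  have h4 := one_add_mul_le_pow (a := -(1 / ((m + 1 : ℕ) : ℝ))) (by linarith) (j + 1)
  have h5 : 0 ≤ (1 - 1 / ((m + 1 : ℕ) : ℝ)) ^ (j + 1) := pow_nonneg (by linarith) _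
  rw [← sub_eq_add_neg] at h4
  calc _ ≤ Real.exp (-1) * (1 - 1 / ((m + 1 : ℕ) : ℝ)) ^ (j + 1) := by
        refine mul_le_mul_of_nonneg_left (le_trans (le_of_eq ?_) h4) (Real.exp_pos _).le
        push_cast; ring
    _ ≤ (1 - 1 / ((m + 1 : ℕ) : ℝ)) ^ m * (1 - 1 / ((m + 1 : ℕ) : ℝ)) ^ (j + 1) :=
        mul_le_mul_of_nonneg_right h1 h5
    _ = _ := by rw [← pow_add]; congr 1; omega

/-- The relative decrease of consecutive layers. It is chosen as large as possible, subject to the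
last of the `r + 1` layers not being smaller than the first one by more than a small power
of `n`. -/
noncomputable def layerDecrease (n r : ℕ) : ℝ := min (1 / 2) (Real.log n / (16 * r))

/-- The rate of the hardness bound. -/
noncomputable def hardnessRate (n r : ℕ) : ℝ := min (1 / (r : ℝ)) (Real.log n ^ 2 / (r : ℝ) ^ 3)

theorem hardnessRate_le {n r : ℕ} (hr : 1 ≤ r) :
    hardnessRate n r / 256 ≤ layerDecrease n r ^ 2 / r := by
  have hr' : (0 : ℝ) < r := by exact_mod_cast hr
  unfold hardnessRate layerDecrease
  rcases min_choice (1 / 2 : ℝ) (Real.log n / (16 * r)) with h | h <;> rw [h]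
  · have h1 := min_le_left (1 / (r : ℝ)) (Real.log n ^ 2 / (r : ℝ) ^ 3)
    have h2 : (1 / 2 : ℝ) ^ 2 / r = 1 / r / 4 := by ring
    rw [h2]
    have : 0 < 1 / (r : ℝ) := by positivity
    linarith
  · have h1 := min_le_right (1 / (r : ℝ)) (Real.log n ^ 2 / (r : ℝ) ^ 3)
    have h2 : (Real.log n / (16 * r)) ^ 2 / r = Real.log n ^ 2 / (r : ℝ) ^ 3 / 256 := by
      field_simp; norm_num
    rw [h2]
    linarith

theorem hardnessRate_ge {n r : ℕ} {b : ℝ} (hr : 1 ≤ r) (hrb : (r : ℝ) ≤ b) (hb : 1 ≤ b)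
    (hlog : 1 ≤ Real.log n) : 1 / b ^ 3 ≤ hardnessRate n r := by
  have hr' : (0 : ℝ) < r := by exact_mod_cast hr
  refine le_min ?_ ?_
  · refine one_div_le_one_div_of_le hr' (hrb.trans ?_)
    exact le_self_pow₀ hb (by norm_num)
  · exact div_le_div₀ (by positivity) (one_le_pow₀ hlog) (by positivity)
      (pow_le_pow_left₀ hr'.le hrb 3)

namespace LayerParams

/-- The parameters in terms of `b = n ^ (1/32)`. With `K ≈ b⁸`, hidden density `b⁻⁸` and the
saturation size `T₀ = 24 K b⁴`, a query below `T₀` meets `O(b⁴)` hidden elements, so `j₀ / K` and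
`τ` are `O(b⁻⁴)`, which is below the gain of order at least `r⁻³ ≥ b⁻³`. -/
noncomputable def ofScale (n r : ℕ) (b Λ : ℝ) (hb : 1 < b) (hΛ : 0 ≤ Λ)
    (hlog : 0 ≤ Real.log n) : LayerParams where
  r := r
  K := ⌈b ^ 8⌉₊
  j₀ := ⌈2 * (1 / b ^ 8) * (24 * ⌈b ^ 8⌉₊ * b ^ 4) + Λ⌉₊
  a := 1 - layerDecrease n r / 2
  slack := 4 * Λ / layerDecrease n r
  τ := 1 / b ^ 4
  K_pos := Nat.ceil_pos.2 (by positivity)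
  a_nonneg := by
    have : layerDecrease n r ≤ 1 / 2 := min_le_left _ _
    linarith
  a_le_one := by
    have : 0 ≤ layerDecrease n r := le_min (by norm_num) (div_nonneg hlog (by positivity))
    linarith
  slack_nonneg := by
    have : 0 ≤ layerDecrease n r := le_min (by norm_num) (div_nonneg hlog (by positivity))
    positivity
  τ_nonneg := by positivity
  τ_le_one := by
    rw [div_le_one (by positivity)]
    exact one_le_pow₀ hb.le

section Scale

variable {n r d : ℕ} {b Λ : ℝ} {hb1 : 1 < b} {hΛ0 : 0 ≤ Λ} {hlog0 : 0 ≤ Real.log n}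

theorem ofScale_K_le (hb : 10 ^ 8 ≤ b) :
    ((ofScale n r b Λ hb1 hΛ0 hlog0).K : ℝ) ≤ 2 * b ^ 8 := by
  have h := Nat.ceil_lt_add_one (show 0 ≤ b ^ 8 by positivity)
  have h1 : 1 ≤ b ^ 8 := one_le_pow₀ (by linarith)
  change (⌈b ^ 8⌉₊ : ℝ) ≤ _
  linarith

theorem ofScale_le_K : b ^ 8 ≤ ((ofScale n r b Λ hb1 hΛ0 hlog0).K : ℝ) := Nat.le_ceil _

theorem ofScale_j₀_le (hb : 10 ^ 8 ≤ b) (hΛ : 100 * Λ ≤ b) :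
    ((ofScale n r b Λ hb1 hΛ0 hlog0).j₀ : ℝ) ≤ 97 * b ^ 4 := by
  have hK := ofScale_K_le (n := n) (r := r) (hb1 := hb1) (hΛ0 := hΛ0) (hlog0 := hlog0) hb
  have hb0 : 0 < b := by linarith
  have h := Nat.ceil_lt_add_one
    (show 0 ≤ 2 * (1 / b ^ 8) * (24 * ⌈b ^ 8⌉₊ * b ^ 4) + Λ by positivity)
  have h1 : 2 * (1 / b ^ 8) * (24 * ⌈b ^ 8⌉₊ * b ^ 4) ≤ 96 * b ^ 4 := by
    change ((⌈b ^ 8⌉₊ : ℕ) : ℝ) ≤ 2 * b ^ 8 at hK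
    calc 2 * (1 / b ^ 8) * (24 * ⌈b ^ 8⌉₊ * b ^ 4)
        ≤ 2 * (1 / b ^ 8) * (24 * (2 * b ^ 8) * b ^ 4) := by gcongr
      _ = 96 * b ^ 4 := by field_simp; norm_num
  have h2 : b ≤ b ^ 4 := le_self_pow₀ (by linarith) (by norm_num)
  change (⌈2 * (1 / b ^ 8) * (24 * ⌈b ^ 8⌉₊ * b ^ 4) + Λ⌉₊ : ℝ) ≤ _
  linarith

theorem layerDecrease_ge (hr : 1 ≤ r) (hrb : (r : ℝ) ≤ b) (hb : 10 ^ 8 ≤ b)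
    (hlog : 1 ≤ Real.log n) : 1 / (16 * b) ≤ layerDecrease n r := by
  have hr' : (0 : ℝ) < r := by exact_mod_cast hr
  refine le_min ?_ ?_
  · exact one_div_le_one_div_of_le (by norm_num) (by linarith)
  · exact div_le_div₀ (by linarith) hlog (by positivity) (by linarith)

theorem ofScale_admissible (hn : b ^ 32 = n) (hr : 1 ≤ r) (hrb : (r : ℝ) ≤ b) (hb : 10 ^ 8 ≤ b)
    (hlog : 1 ≤ Real.log n) (hΛ : 100 * Λ ≤ b) :
    (ofScale n r b Λ hb1 hΛ0 hlog0).Admissible n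
      (fun l => rawWeight r (layerDecrease n r) (1 / b ^ 8) l /
        ∑ l ∈ Finset.range (r + 2), rawWeight r (layerDecrease n r) (1 / b ^ 8) l)
      (layerDecrease n r) (1 / b ^ 8) Λ (24 * ⌈b ^ 8⌉₊ * b ^ 4) := by
  have hb0 : 0 < b := by linarith
  have hr' : (0 : ℝ) < r := by exact_mod_cast hr
  have hg := layerDecrease_ge (n := n) hr hrb hb hlog
  have hgpos : 0 < layerDecrease n r := lt_of_lt_of_le (by positivity) hg
  have hghalf : layerDecrease n r ≤ 1 / 2 := min_le_left _ _
  have hglog : layerDecrease n r ≤ Real.log n / (16 * r) := min_le_right _ _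
  have hKle := ofScale_K_le (n := n) (r := r) (hb1 := hb1) (hΛ0 := hΛ0) (hlog0 := hlog0) hb
  have hKge := ofScale_le_K (n := n) (r := r) (hb1 := hb1) (hΛ0 := hΛ0) (hlog0 := hlog0)
  have hj := ofScale_j₀_le (n := n) (r := r) (hb1 := hb1) (hΛ0 := hΛ0) (hlog0 := hlog0) hb hΛ
  have hq0 : 0 < 1 / b ^ 8 := by positivity
  have hpow : ∀ i j : ℕ, i ≤ j → b ^ i ≤ b ^ j := fun i j h => pow_le_pow_right₀ (by linarith) h
  have hb14 : b ≤ b ^ 4 := le_self_pow₀ (by linarith) (by norm_num)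
  have hb18 : b ≤ b ^ 8 := le_self_pow₀ (by linarith) (by norm_num)
  have hq1 : 1 / b ^ 8 ≤ 1 / 8 := one_div_le_one_div_of_le (by norm_num) (by linarith)
  set g := layerDecrease n r with hgdef
  set q := 1 / b ^ 8 with hqdef
  have hw : ∀ l, 0 < rawWeight r g q l := rawWeight_pos hghalf hq0
  have hW := sum_rawWeight_le (r := r) hgpos.le hghalf hq0.le (by linarith)
  have hWpos : 0 < ∑ l ∈ Finset.range (r + 2), rawWeight r g q l :=
    Finset.sum_pos (fun l _ => hw l) ⟨0, by simp⟩
  set W := ∑ l ∈ Finset.range (r + 2), rawWeight r g q l with hWdef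
  have hT : (⌈b ^ 8⌉₊ : ℝ) ≤ 24 * ⌈b ^ 8⌉₊ * b ^ 4 / 24 / 10 ^ 8 := by
    have : (0 : ℝ) ≤ ⌈b ^ 8⌉₊ := Nat.cast_nonneg _
    have : (⌈b ^ 8⌉₊ : ℝ) * 10 ^ 8 ≤ ⌈b ^ 8⌉₊ * b ^ 4 :=
      mul_le_mul_of_nonneg_left (by linarith) this
    linarith
  have hKeq : ((ofScale n r b Λ hb1 hΛ0 hlog0).K : ℝ) = ⌈b ^ 8⌉₊ := rfl
  rw [hKeq] at hKle hKge
  have hb48 : b ^ 4 ≤ b ^ 8 := hpow 4 8 (by norm_num)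
  refine
  { g_pos := hgpos
    g_le := hghalf
    a_eq := rfl
    slack_eq := rfl
    p_pos := fun l => div_pos (hw l) hWpos
    sum_p := ?_
    decay := ?_
    hidden_le := ?_
    q_nonneg := hq0.le
    q_le := hq1
    Λ_le := ?_
    j₀_ge := Nat.le_ceil _
    τ_ge := ?_
    card_le := ?_
    slack_le := ?_
    hidden_ge := ?_ }
  · change ∑ l ∈ Finset.range (r + 2), rawWeight r g q l / W = 1
    rw [← Finset.sum_div, div_self hWpos.ne']
  · intro j hj'
    change j < r at hj'
    rw [← mul_div_assoc]
    refine div_le_div_of_nonneg_right (le_of_eq ?_) hWpos.le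
    rw [rawWeight, rawWeight, if_neg (by omega), if_neg (by omega), pow_succ]
    ring
  · change rawWeight r g q (r + 1) / W ≤ q * (rawWeight r g q r / W)
    rw [← mul_div_assoc]
    refine div_le_div_of_nonneg_right (le_of_eq ?_) hWpos.le
    rw [rawWeight, rawWeight, if_pos rfl, if_neg (by omega)]
  · linarith
  · change 24 * (⌈b ^ 8⌉₊ : ℝ) ≤ 1 / b ^ 4 * (24 * ⌈b ^ 8⌉₊ * b ^ 4)
    refine le_of_eq ?_
    field_simp
  · rw [hKeq]
    linarith
  · change 2 * ((r : ℝ) + 1) * (4 * Λ / g) ≤ (1 - (1 - g / 2)) * (⌈b ^ 8⌉₊ : ℝ)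
    have h1 : 4 * Λ / g ≤ b ^ 2 := by
      rw [div_le_iff₀ hgpos]
      have h2 : b ^ 2 * (1 / (16 * b)) ≤ b ^ 2 * g := mul_le_mul_of_nonneg_left hg (by positivity)
      have h3 : b ^ 2 * (1 / (16 * b)) = b / 16 := by field_simp
      linarith
    have h4 : 2 * ((r : ℝ) + 1) * (4 * Λ / g) ≤ (4 * b) * b ^ 2 :=
      mul_le_mul (by linarith) h1 (by positivity) (by positivity)
    have h5 : 1 / (16 * b) / 2 * b ^ 8 ≤ g / 2 * (⌈b ^ 8⌉₊ : ℝ) :=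
      mul_le_mul (by linarith) hKge (by positivity) (by linarith)
    have h6 : 1 / (16 * b) / 2 * b ^ 8 = b ^ 3 * b ^ 4 / 32 := by field_simp; norm_num
    have h7 : b ^ 3 * 128 ≤ b ^ 3 * b ^ 4 :=
      mul_le_mul_of_nonneg_left (by linarith) (by positivity)
    nlinarith
  · change (⌈b ^ 8⌉₊ : ℝ) + _ + Λ ≤ n * (rawWeight r g q (r + 1) / W) / 2
    have h1 : 1 / b ^ 4 ≤ (1 - g) ^ r := by
      refine le_trans ?_ (exp_neg_le_one_sub_pow hgpos.le hghalf r)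
      have h2 : 2 * g * r ≤ Real.log n / 8 := by
        have := mul_le_mul_of_nonneg_right hglog hr'.le
        have h3 : Real.log n / (16 * r) * r = Real.log n / 16 := by field_simp
        linarith
      have h4 : Real.log n / 8 = Real.log (b ^ 4) := by
        rw [← hn, Real.log_pow, Real.log_pow]
        push_cast; ring
      rw [Real.exp_neg, one_div]
      refine inv_anti₀ (Real.exp_pos _) ?_
      calc Real.exp (2 * g * r) ≤ Real.exp (Real.log (b ^ 4)) :=
            Real.exp_le_exp.2 (h4 ▸ h2)
        _ = b ^ 4 := Real.exp_log (by positivity)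
    have h2 : 1 / b ^ 12 ≤ rawWeight r g q (r + 1) := by
      rw [rawWeight, if_pos rfl]
      have := mul_le_mul_of_nonneg_left h1 hq0.le
      refine le_trans (le_of_eq ?_) this
      rw [hqdef]; field_simp
    have h3 : 1 / b ^ 12 / (3 * b) ≤ rawWeight r g q (r + 1) / W :=
      div_le_div₀ (hw _).le h2 hWpos (by linarith)
    have h4 : (n : ℝ) * (1 / b ^ 12 / (3 * b)) ≤ n * (rawWeight r g q (r + 1) / W) :=
      mul_le_mul_of_nonneg_left h3 (Nat.cast_nonneg _)
    have h5 : (n : ℝ) * (1 / b ^ 12 / (3 * b)) = b ^ 8 * b ^ 11 / 3 := by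
      rw [← hn]; field_simp
    have h6 : b ≤ b ^ 11 := le_self_pow₀ (by linarith) (by norm_num)
    have h7 : b ^ 8 * 1000 ≤ b ^ 8 * b ^ 11 :=
      mul_le_mul_of_nonneg_left (by linarith) (by positivity)
    linarith

/-- The bound that is achieved with high probability is below `1 - 1/e` by a constant multiple of
`hardnessRate`, also when the small errors are taken into account. -/
theorem ofScale_bound_le (hr : 1 ≤ r) (hrb : (r : ℝ) ≤ b) (hb : 10 ^ 8 ≤ b)
    (hlog : 1 ≤ Real.log n) (hΛ : 100 * Λ ≤ b) :
    (ofScale n r b Λ hb1 hΛ0 hlog0).bound + 1 / b ^ 4 ≤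
      (1 - 1 / Real.exp 1 - 1 / 10 ^ 6 * hardnessRate n r) * (1 - 1 / b ^ 4) := by
  have hb0 : 0 < b := by linarith
  have hr' : (1 : ℝ) ≤ r := by exact_mod_cast hr
  have hKge := ofScale_le_K (n := n) (r := r) (hb1 := hb1) (hΛ0 := hΛ0) (hlog0 := hlog0)
  have hj := ofScale_j₀_le (n := n) (r := r) (hb1 := hb1) (hΛ0 := hΛ0) (hlog0 := hlog0) hb hΛ
  have hb14 : b ≤ b ^ 4 := le_self_pow₀ (by linarith) (by norm_num)
  have hb18 : b ≤ b ^ 8 := le_self_pow₀ (by linarith) (by norm_num)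
  have hG1 := hardnessRate_le (n := n) hr
  have hG2 := hardnessRate_ge (n := n) hr hrb (by linarith) hlog
  have hghalf : layerDecrease n r ≤ 1 / 2 := min_le_left _ _
  have hgpos : 0 ≤ layerDecrease n r := le_trans (by positivity) (layerDecrease_ge hr hrb hb hlog)
  set P := ofScale n r b Λ hb1 hΛ0 hlog0 with hP
  set G := hardnessRate n r
  set g := layerDecrease n r with hgdef
  have hG0 : 0 < G := lt_of_lt_of_le (by positivity) hG2
  have hK2 : 2 ≤ P.K := by
    have : (2 : ℝ) ≤ P.K := by linarith
    exact_mod_cast this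
  have hpow := one_sub_inv_pow_ge hK2 P.j₀
  -- the loss that comes from hiding
  have herr : ((P.j₀ : ℝ) + 1) * (1 / P.K) ≤ 98 * (1 / b ^ 4) := by
    have h1 : 1 / (P.K : ℝ) ≤ 1 / b ^ 8 := one_div_le_one_div_of_le (by positivity) hKge
    have h2 : (P.j₀ : ℝ) + 1 ≤ 98 * b ^ 4 := by linarith
    calc ((P.j₀ : ℝ) + 1) * (1 / P.K) ≤ (98 * b ^ 4) * (1 / b ^ 8) :=
          mul_le_mul h2 h1 (by positivity) (by positivity)
      _ = 98 * (1 / b ^ 4) := by field_simp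
  have herr0 : 0 ≤ ((P.j₀ : ℝ) + 1) * (1 / P.K) := by positivity
  set err := ((P.j₀ : ℝ) + 1) * (1 / P.K)
  set y := (1 - P.a) ^ 2 / (64 * ((P.r : ℝ) + 1)) with hy
  have hyeq : y = g ^ 2 / (256 * ((r : ℝ) + 1)) := by
    have h1 : 1 - P.a = g / 2 := by
      change 1 - (1 - g / 2) = g / 2
      ring
    have h2 : (P.r : ℝ) = r := rfl
    rw [hy, h1, h2]
    field_simp; ring
  have hy1 : G / (256 * 512) ≤ y := by
    have h1 : g ^ 2 / (512 * r) ≤ y := by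
      rw [hyeq]
      exact div_le_div_of_nonneg_left (sq_nonneg _) (by positivity) (by linarith)
    have h2 : g ^ 2 / (512 * r) = g ^ 2 / r / 512 := by field_simp
    rw [h2] at h1
    linarith
  have hy2 : y ≤ 1 := by
    rw [hyeq, div_le_one (by positivity)]
    nlinarith
  have hE1 : 1 / 3 ≤ Real.exp (-1) := by
    rw [Real.exp_neg, one_div]
    exact inv_anti₀ (Real.exp_pos _) (by linarith [Real.exp_one_lt_d9])
  have hE2 : Real.exp (-1) ≤ 1 / 2 := by
    rw [Real.exp_neg, one_div]
    exact inv_anti₀ (by norm_num) (by linarith [Real.add_one_le_exp (1 : ℝ)])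
  have hE3 : 1 / Real.exp 1 = Real.exp (-1) := by rw [Real.exp_neg, one_div]
  have hb4 : 0 < 1 / b ^ 4 := by positivity
  have hb43 : 10 ^ 8 * (1 / b ^ 4) ≤ 1 / b ^ 3 := by
    have : 1 / b ^ 3 = b * (1 / b ^ 4) := by field_simp
    rw [this]
    exact mul_le_mul_of_nonneg_right hb hb4.le
  have hbound : P.bound ≤ 1 - Real.exp (-1) * (1 + y - 2 * err) := by
    have h1 : Real.exp (-1) * (1 - err) * (1 + y) ≤ (1 - P.h) ^ (P.K + P.j₀) * (1 + y) :=
      mul_le_mul_of_nonneg_right hpow (by linarith)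
    have h2 : Real.exp (-1) * (1 + y - 2 * err) ≤ Real.exp (-1) * ((1 - err) * (1 + y)) :=
      mul_le_mul_of_nonneg_left (by nlinarith) (by linarith)
    unfold bound
    linarith
  rw [hE3]
  have h3 : 1 / 3 * y ≤ Real.exp (-1) * y := mul_le_mul_of_nonneg_right hE1 (by linarith)
  have h4 : Real.exp (-1) * (2 * err) ≤ 1 / 2 * (2 * err) :=
    mul_le_mul_of_nonneg_right hE2 (by linarith)
  have h5 : (Real.exp (-1) + 1 / 10 ^ 6 * G) * (1 / b ^ 4) ≥ 0 := by positivity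
  linarith

/-- The probability that an algorithm with `n ^ d` queries per round beats the bound is small. -/
theorem failure_probability_le (hn : b ^ 32 = n) (hr : 1 ≤ r) (hrb : (r : ℝ) ≤ b)
    (hb : 10 ^ 8 ≤ b) :
    (((r : ℝ) * (n ^ d : ℕ) + 1) * (r + 1) + 1) * Real.exp (-((2 * d + 2 : ℕ) * Real.log n)) ≤
      1 / (n : ℝ) ^ d * (1 / b ^ 4) := by
  have hb0 : 0 < b := by linarith
  have hr' : (1 : ℝ) ≤ r := by exact_mod_cast hr
  have hb1 : b ≤ b ^ 32 := le_self_pow₀ (by linarith) (by norm_num)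
  have hn1 : (1 : ℝ) ≤ n := by linarith
  have hn0 : (0 : ℝ) < n := by linarith
  have hnd : (1 : ℝ) ≤ (n : ℝ) ^ d := one_le_pow₀ hn1
  rw [Real.exp_neg, Real.exp_nat_mul, Real.exp_log hn0]
  push_cast
  have h1 : ((r : ℝ) * (n : ℝ) ^ d + 1) * (r + 1) + 1 ≤ 5 * b ^ 2 * (n : ℝ) ^ d := by
    have h2 : (r : ℝ) * (n : ℝ) ^ d + 1 ≤ 2 * b * (n : ℝ) ^ d := by nlinarith
    have h3 : ((r : ℝ) * (n : ℝ) ^ d + 1) * (r + 1) ≤ (2 * b * (n : ℝ) ^ d) * (2 * b) :=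
      mul_le_mul h2 (by linarith) (by positivity) (by positivity)
    have h4 : 1 ≤ b ^ 2 * (n : ℝ) ^ d := one_le_mul_of_one_le_of_one_le
      (one_le_pow₀ (by linarith)) hnd
    linarith
  have h5 : 5 * b ^ 6 ≤ (n : ℝ) ^ 2 := by
    rw [← hn, ← pow_mul]
    calc 5 * b ^ 6 ≤ b * b ^ 6 := mul_le_mul_of_nonneg_right (by linarith) (by positivity)
      _ = b ^ 7 := by ring
      _ ≤ b ^ (32 * 2) := pow_le_pow_right₀ (by linarith) (by norm_num)
  calc _ ≤ 5 * b ^ 2 * (n : ℝ) ^ d * ((n : ℝ) ^ (2 * d + 2))⁻¹ :=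
        mul_le_mul_of_nonneg_right h1 (by positivity)
    _ = 5 * b ^ 6 * (1 / (n : ℝ) ^ d * (1 / b ^ 4)) * ((n : ℝ) ^ 2)⁻¹ := by
        rw [pow_add, two_mul, pow_add]
        field_simp
    _ ≤ (n : ℝ) ^ 2 * (1 / (n : ℝ) ^ d * (1 / b ^ 4)) * ((n : ℝ) ^ 2)⁻¹ := by gcongr
    _ = 1 / (n : ℝ) ^ d * (1 / b ^ 4) := by field_simp

end Scale

end LayerParams

open LayerParams in
theorem noBetterApproximation_of_scale {n r d : ℕ} {b : ℝ} (hn : b ^ 32 = n) (hr : 1 ≤ r)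
    (hrb : (r : ℝ) ≤ b) (hb : 10 ^ 8 ≤ b) (hlog : 1 ≤ Real.log n)
    (hΛ : 100 * ((2 * d + 2 : ℕ) * Real.log n) ≤ b) :
    NoBetterApproximation n r (n ^ d)
      (1 - 1 / Real.exp 1 - 1 / 10 ^ 6 * hardnessRate n r) (1 / (n : ℝ) ^ d) := by
  have hb1 : 1 < b := by linarith
  have hlog0 : 0 ≤ Real.log n := by linarith
  have hΛ0 : 0 ≤ ((2 * d + 2 : ℕ) * Real.log n) := by positivity
  have hb14 : b ≤ b ^ 4 := le_self_pow₀ (by linarith) (by norm_num)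
  have hb81 : b ^ 4 ≤ b ^ 8 := pow_le_pow_right₀ (by linarith) (by norm_num)
  have hb832 : b ^ 9 ≤ b ^ 32 := pow_le_pow_right₀ (by linarith) (by norm_num)
  have hb4 : 1 / b ^ 4 < 1 := by
    rw [div_lt_one (by positivity)]
    linarith
  have hb40 : 0 < 1 / b ^ 4 := by positivity
  have hn1 : (1 : ℝ) ≤ n := by
    rw [← hn]; exact one_le_pow₀ hb1.le
  have hnd : 1 / (n : ℝ) ^ d ≤ 1 := by
    rw [div_le_one (by positivity)]
    exact one_le_pow₀ hn1
  have hnd0 : 0 ≤ 1 / (n : ℝ) ^ d := by positivity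
  have hadm := ofScale_admissible (hb1 := hb1) (hΛ0 := hΛ0) (hlog0 := hlog0) hn hr hrb hb hlog hΛ
  have hbound := ofScale_bound_le (hb1 := hb1) (hΛ0 := hΛ0) (hlog0 := hlog0) hr hrb hb hlog hΛ
  have hKle := ofScale_K_le (n := n) (r := r) (hb1 := hb1) (hΛ0 := hΛ0) (hlog0 := hlog0) hb
  have hj := ofScale_j₀_le (n := n) (r := r) (hb1 := hb1) (hΛ0 := hΛ0) (hlog0 := hlog0) hb hΛ
  have hη1 : 1 / (n : ℝ) ^ d * (1 / b ^ 4) ≤ 1 / b ^ 4 := by nlinarith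
  refine (hadm.noBetterApproximation ?_ hb4
    (failure_probability_le (d := d) hn hr hrb hb) (lt_of_le_of_lt hη1 hb4) ?_).mono ?_
  · have h1 : b ^ 8 * 100 ≤ b ^ 9 := by
      rw [pow_succ b 8]
      exact mul_le_mul_of_nonneg_left (by linarith) (by positivity)
    have h2 : (((ofScale n r b _ hb1 hΛ0 hlog0).K + (ofScale n r b _ hb1 hΛ0 hlog0).j₀ : ℕ) : ℝ)
        ≤ n := by
      rw [Nat.cast_add]
      linarith
    exact_mod_cast h2
  · exact le_trans (by linarith) hbound
  · nlinarith

theorem mainTheorem2 :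
    ∃ c : ℝ, 0 < c ∧ ∃ κ : ℝ, 0 < κ ∧ ∀ d : ℕ, ∃ n₀ : ℕ, ∀ n r : ℕ, n₀ ≤ n →
      1 ≤ r → (r : ℝ) < (n : ℝ) ^ c →
      (Real.log n < r →
        NoBetterApproximation n r (n ^ d)
          (1 - 1 / Real.exp 1 - κ * (Real.log n ^ 2 / (r : ℝ) ^ 3)) (1 / (n : ℝ) ^ d)) ∧
      NoBetterApproximation n r (n ^ d)
        (1 - 1 / Real.exp 1 - κ * min (1 / (r : ℝ)) (Real.log n ^ 2 / (r : ℝ) ^ 3))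
        (1 / (n : ℝ) ^ d) := by
  refine ⟨1 / 32, by norm_num, 1 / 10 ^ 6, by norm_num, fun d => ?_⟩
  have hrpow : Filter.Tendsto (fun n : ℕ => (n : ℝ) ^ (1 / 32 : ℝ)) Filter.atTop Filter.atTop :=
    (tendsto_rpow_atTop (by norm_num)).comp tendsto_natCast_atTop_atTop
  have hlog : Filter.Tendsto (fun n : ℕ => Real.log n) Filter.atTop Filter.atTop :=
    Real.tendsto_log_atTop.comp tendsto_natCast_atTop_atTop
  have hlittle := ((isLittleO_log_rpow_atTop (show (0 : ℝ) < 1 / 32 by norm_num)).comp_tendsto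
    tendsto_natCast_atTop_atTop).bound
      (show (0 : ℝ) < 1 / (100 * (2 * d + 2 : ℕ)) by positivity)
  obtain ⟨n₀, hn₀⟩ := Filter.eventually_atTop.1 ((hrpow.eventually_ge_atTop (10 ^ 8)).and
    ((hlog.eventually_ge_atTop 1).and hlittle))
  refine ⟨n₀, fun n r hn hr hrc => ?_⟩
  obtain ⟨hb, hl, hΛ⟩ := hn₀ n hn
  have hb32 : ((n : ℝ) ^ (1 / 32 : ℝ)) ^ 32 = n := by
    rw [← Real.rpow_natCast, ← Real.rpow_mul (Nat.cast_nonneg _)]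
    norm_num
  have hΛ' : 100 * ((2 * d + 2 : ℕ) * Real.log n) ≤ (n : ℝ) ^ (1 / 32 : ℝ) := by
    simp only [Function.comp_apply, Real.norm_eq_abs] at hΛ
    rw [abs_of_nonneg (by linarith), abs_of_nonneg (by linarith), div_mul_eq_mul_div, one_mul,
      le_div_iff₀ (by positivity)] at hΛ
    linarith
  have main := noBetterApproximation_of_scale (d := d) hb32 hr hrc.le hb hl hΛ'
  refine ⟨fun hlogr => ?_, main⟩
  have hr' : (0 : ℝ) < r := by exact_mod_cast hr
  -- for `r > log n` the second term is the minimum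
  have hmin : hardnessRate n r = Real.log n ^ 2 / (r : ℝ) ^ 3 := by
    refine min_eq_right ?_
    rw [div_le_div_iff₀ (by positivity) hr', one_mul, pow_succ (r : ℝ) 2]
    exact mul_le_mul_of_nonneg_right (pow_le_pow_left₀ (by linarith) hlogr.le 2) hr'.le
  rwa [hmin] at main
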